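/- Let $H(\mathbb C)$ be the algebra of entire functions with the compact-open topology and $D$ the operator of complex differentiation. An entire function $\Phi(z)=\sum_{n\ge 0}a_nz^n$ is of exponential type if there are $M,R>0$ with $|a_n|\le M R^n/n!$ for all $n\ge 0$; it then induces the convolution operator $\Phi(D):H(\mathbb C)\to H(\mathbb C)$, $\Phi(D)f=\sum_{n\ge0}a_nD^nf$. The set of hypercyclic vectors of $\Phi(D)$ is $HC(\Phi(D))=\{f:\ \{f,\Phi(D)f,\Phi(D)^2f,\dots\}\text{ is dense in }H(\mathbb C)\}$. Subalgebras are not required to be unital. For a finite or infinite sequence $f=(f_j)$ in $H(\mathbb C)$, $A(f)$ denotes the subalgebra generated by the $f_j$; a hypercyclic algebra for $\Phi(D)$ is a subalgebra all of whose non-zero elements lie in $HC(\Phi(D))$. A family $(y_i)_{i\in I}$ of elements of a commutative (not necessarily unital) complex algebra $A$ is a family of free generators of $A$ if every map $y_i\mapsto a_i$ into a commutative complex algebra $A'$ extends uniquely to an algebra homomorphism $A\to A'$; $f$ freely generates $A(f)$ if $(f_j)$ is a family of free generators of $A(f)$. A set is residual if its complement is of first category; $H(\mathbb C)^N$ and $H(\mathbb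 C)^{\mathbb N}$ carry the product topology. **Theorem.** Let $\Phi$ be an entire function of exponential type with $|\Phi(0)|<1$ such that the level set $\{z:|\Phi(z)|=1\}$ contains a compact arc $\Gamma$ (a continuous image of $[0,1]$) that is non-trivial (has more than one point), is strictly convex (each segment with both endpoints in $\Gamma$ meets $\Gamma$ only at these endpoints), and satisfies $$\operatorname{conv}(\Gamma\cup\{0\})\setminus\Gamma\ \subset\ \{z:|\Phi(z)|<1\}.$$ Then $HC(\Phi(D))$ is dense algebrable, that is, $HC(\Phi(D))\cup\{0\}$ contains a dense subalgebra of $H(\mathbb C)$ that is not finitely generated. Moreover: (a) for each integer $N\ge1$, the set of $f=(f_j)_{j=1}^N\in H(\mathbb C)^N$ that freely generate a hypercyclic algebra for $\Phi(D)$ is residual in $H(\mathbb C)^N$; (b) the set of $f=(f_j)_{j=1}^\infty\in H(\mathbb C)^{\mathbb N}$ that freely generate a dense hypercyclic algebra for $\Phi(D)$ is residual in $H(\mathbb C)^{\mathbb N}$. In particular, $HC(\Phi(D))$ is densely strongly algebrable: for some infinite cardinal $\kappa$, $HC(\Phi(D))\cup\{0\}$ contains a dense subalgebra of $H(\mathbb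 C)$ that has a set of free generators of cardinality $\kappa$. -/

import Mathlib

open Filter Topology
open scoped Cardinal

/-! ### The algebra of entire functions -/

/-- The algebra of entire functions, as a subalgebra of the algebra `C(ℂ, ℂ)` of continuous
functions. It carries the topology induced by `C(ℂ, ℂ)`, i.e. the compact-open topology. -/
def entireFunctions : Subalgebra ℂ C(ℂ, ℂ) where
  carrier := {f | Differentiable ℂ f}
  mul_mem' hf hg := Differentiable.mul hf hg
  add_mem' hf hg := Differentiable.add hf hg
  algebraMap_mem' c := differentiable_const c

/-- Complex differentiation on the space of entire functions. -/
noncomputable def entireDeriv : entireFunctions →ₗ[ℂ] entireFunctions where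
  toFun f :=
    ⟨⟨deriv f.1, ((f.2 : Differentiable ℂ f.1).contDiff (n := 1)).continuous_deriv_one⟩,
      fun z => ((f.2 : Differentiable ℂ f.1).analyticAt z).deriv.differentiableAt⟩
  map_add' f g := by
    ext z
    exact deriv_add (f.2 z) (g.2 z)
  map_smul' c f := by
    ext z
    exact deriv_const_smul c (f.2 z)

/-! ### Convolution operators -/

/-- The `n`-th Taylor coefficient at the origin. -/
noncomputable def taylorCoeffZero (Φ : ℂ → ℂ) (n : ℕ) : ℂ :=
  iteratedDeriv n Φ 0 / (n.factorial : ℂ)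

/-- An entire function `Φ(z) = ∑ aₙ zⁿ` is of exponential type if `|aₙ| ≤ M Rⁿ / n!` for all `n`,
for some `M, R > 0`. -/
def IsEntireOfExponentialType (Φ : ℂ → ℂ) : Prop :=
  Differentiable ℂ Φ ∧ ∃ M R : ℝ, 0 < M ∧ 0 < R ∧
    ∀ n : ℕ, ‖taylorCoeffZero Φ n‖ ≤ M * R ^ n / (n.factorial : ℝ)

/-- The convolution operator `Φ(D) : f ↦ ∑ aₙ Dⁿ f`, where `Φ(z) = ∑ aₙ zⁿ`. The series is taken in
the space of entire functions; it converges when `Φ` is of exponential type, see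
`hasSum_convolutionOperator`. -/
noncomputable def convolutionOperator (Φ : ℂ → ℂ) (f : entireFunctions) : entireFunctions :=
  ∑' n : ℕ, taylorCoeffZero Φ n • (entireDeriv ^ n) f

theorem entireDeriv_pow_apply (n : ℕ) (f : entireFunctions) (z : ℂ) :
    ((entireDeriv ^ n) f).1 z = iteratedDeriv n f.1 z := by
  induction n generalizing z with
  | zero => simp
  | succ n ih =>
    rw [pow_succ', iteratedDeriv_succ]
    have h : (((entireDeriv ^ n) f).1 : ℂ → ℂ) = iteratedDeriv n f.1 := funext ih
    rw [← h]
    rfl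

/-- The series defining a convolution operator converges in the space of entire functions. -/
theorem hasSum_convolutionOperator {Φ : ℂ → ℂ} (hΦ : IsEntireOfExponentialType Φ)
    (f : entireFunctions) :
    HasSum (fun n : ℕ => taylorCoeffZero Φ n • (entireDeriv ^ n) f)
      (convolutionOperator Φ f) := by
  obtain ⟨-, M, R, hM, hR, ha⟩ := hΦ
  set F : ℕ → entireFunctions := fun n => taylorCoeffZero Φ n • (entireDeriv ^ n) f with hF
  have hsum : Summable fun n => (F n).1 := by
    refine ContinuousMap.summable_of_locally_summable_norm fun K => ?_
    obtain ⟨C, hC⟩ := (K.isCompact.cthickening (r := 2 * R)).exists_bound_of_continuousOn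
      f.1.continuous.continuousOn
    have hC0 : 0 ≤ |C| := abs_nonneg C
    refine Summable.of_norm_bounded (g := fun n : ℕ => (M * |C|) * (1 / 2 : ℝ) ^ n)
      (summable_geometric_two.mul_left _) fun n => ?_
    rw [norm_norm]
    refine (ContinuousMap.norm_le _ (by positivity)).2 fun x => ?_
    have hx : ‖iteratedDeriv n f.1 (x : ℂ)‖ ≤ n.factorial * |C| / (2 * R) ^ n := by
      refine Complex.norm_iteratedDeriv_le_of_forall_mem_sphere_norm_le n (by positivity)
        (f.2 : Differentiable ℂ f.1).diffContOnCl fun z hz => (hC z ?_).trans (le_abs_self C)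
      exact Metric.mem_cthickening_of_dist_le z x _ _ x.2 (le_of_eq hz)
    have hval : ((F n).1.restrict K) x = taylorCoeffZero Φ n * iteratedDeriv n f.1 (x : ℂ) := by
      rw [← entireDeriv_pow_apply]
      rfl
    rw [hval, norm_mul]
    have hn : (0 : ℝ) < n.factorial := by positivity
    calc _ ≤ (M * R ^ n / (n.factorial : ℝ)) * (n.factorial * |C| / (2 * R) ^ n) :=
          mul_le_mul (ha n) hx (norm_nonneg _) (by positivity)
      _ = (M * |C|) * (1 / 2 : ℝ) ^ n := by
          rw [mul_pow, div_pow, one_pow]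
          field_simp
  obtain ⟨g, hg⟩ := hsum
  have hgd : Differentiable ℂ g := by
    rw [← differentiableOn_univ]
    have hg' := (ContinuousMap.tendsto_iff_tendstoLocallyUniformly.1 hg)
    refine (tendstoLocallyUniformlyOn_univ.2 hg').differentiableOn
      (Eventually.of_forall fun s => ?_) isOpen_univ
    have hs : (∑ n ∈ s, (F n).1) = (∑ n ∈ s, F n).1 :=
      (map_sum entireFunctions.val F s).symm
    rw [hs]
    exact (∑ n ∈ s, F n).2.differentiableOn
  have hsum' : HasSum F ⟨g, hgd⟩ :=
    (IsInducing.hasSum_iff (g := entireFunctions.val) IsInducing.subtypeVal F ⟨g, hgd⟩).1 hg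
  exact hsum'.summable.hasSum

/-! ### Hypercyclic vectors -/

/-- The set of hypercyclic vectors of `T`: those with dense orbit. -/
def hypercyclicVectors {X : Type*} [TopologicalSpace X] (T : X → X) : Set X :=
  {f | Dense (Set.range fun n : ℕ => T^[n] f)}

/-- A hypercyclic algebra for `T`: a (not necessarily unital) subalgebra all of whose non-zero
elements are hypercyclic for `T`. -/
def IsHypercyclicAlgebra {X : Type*} [CommRing X] [Algebra ℂ X] [TopologicalSpace X] (T : X → X)
    (A : NonUnitalSubalgebra ℂ X) : Prop :=
  ∀ f ∈ A, f ≠ 0 → f ∈ hypercyclicVectors T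

/-! ### Free generators and algebrability -/

/-- The family `y` is a family of free generators of the (commutative, not necessarily unital)
complex algebra `A`: every map from the index set to a commutative algebra `A'` extends uniquely
to an algebra homomorphism `A → A'`. -/
def IsFreeGenerators {ι A : Type} [NonUnitalCommRing A] [Module ℂ A] (y : ι → A) : Prop :=
  ∀ (A' : Type) [NonUnitalCommRing A'] [Module ℂ A'] [IsScalarTower ℂ A' A']
    [SMulCommClass ℂ A' A'] (g : ι → A'), ∃! φ : A →ₙₐ[ℂ] A', ∀ i, φ (y i) = g i

/-- The subalgebra `A(f)` generated by the family `f`, i.e. the smallest (not necessarily unital)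
subalgebra that contains all `f i`. -/
def generatedAlgebra {ι X : Type} [CommRing X] [Algebra ℂ X] (f : ι → X) :
    NonUnitalSubalgebra ℂ X :=
  NonUnitalAlgebra.adjoin ℂ (Set.range f)

/-- The family `f` freely generates the algebra `A(f)`. -/
def FreelyGenerates {ι X : Type} [CommRing X] [Algebra ℂ X] (f : ι → X) : Prop :=
  IsFreeGenerators fun i : ι =>
    (⟨f i, NonUnitalAlgebra.subset_adjoin ℂ (Set.mem_range_self i)⟩ : generatedAlgebra f)

/-- `A` is a `κ`-generated free algebra. -/
def IsFreeAlgebraOfCardinal (κ : Cardinal.{0}) (A : Type) [NonUnitalCommRing A] [Module ℂ A] :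
    Prop :=
  ∃ Y : Set A, #Y = κ ∧ IsFreeGenerators (fun y : Y => (y : A))

/-- A subalgebra is finitely generated. -/
def IsFinitelyGeneratedAlgebra {X : Type} [CommRing X] [Algebra ℂ X]
    (A : NonUnitalSubalgebra ℂ X) : Prop :=
  ∃ s : Finset X, NonUnitalAlgebra.adjoin ℂ (s : Set X) = A

/-- `E` is dense algebrable: `E ∪ {0}` contains a dense subalgebra that is not finitely
generated. -/
def IsDenseAlgebrable {X : Type} [CommRing X] [Algebra ℂ X] [TopologicalSpace X] (E : Set X) :
    Prop :=
  ∃ A : NonUnitalSubalgebra ℂ X, (A : Set X) ⊆ E ∪ {0} ∧ Dense (A : Set X) ∧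
    ¬ IsFinitelyGeneratedAlgebra A

/-- `E` is densely strongly algebrable: for some infinite cardinal `κ`, `E ∪ {0}` contains a dense
`κ`-generated free subalgebra. -/
def IsDenselyStronglyAlgebrable {X : Type} [CommRing X] [Algebra ℂ X] [TopologicalSpace X]
    (E : Set X) : Prop :=
  ∃ κ : Cardinal.{0}, ℵ₀ ≤ κ ∧ ∃ A : NonUnitalSubalgebra ℂ X,
    (A : Set X) ⊆ E ∪ {0} ∧ Dense (A : Set X) ∧ IsFreeAlgebraOfCardinal κ A

/-! ### Arcs -/

/-- A compact arc: a continuous image of `[0, 1]` (not required to be simple). -/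
def IsCompactArc (Γ : Set ℂ) : Prop :=
  ∃ γ : ℝ → ℂ, ContinuousOn γ (Set.Icc 0 1) ∧ Γ = γ '' Set.Icc 0 1

/-- Every segment with both endpoints in `Γ` meets `Γ` only at these endpoints. -/
def IsStrictlyConvexArc (Γ : Set ℂ) : Prop :=
  ∀ a ∈ Γ, ∀ b ∈ Γ, segment ℝ a b ∩ Γ ⊆ {a, b}

/-! ### Geometry of the arc -/

/-! The exponentials `e a = exp (a z)` satisfy `e (a + b) = e a * e b` and are eigenvectors: `Φ(D)
(e a) = Φ a • e a`. Hence a product of combinations of exponentials is again such a combination, and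
iterating `Φ(D)` multiplies each term by a power of `Φ` at its frequency.

Fix a finite set `A` of non-zero exponents. A generic positive weight `w` on the variables singles
out one `β ∈ A` of weight 1, all others having smaller weight (`exists_weight_unique_maximizer`).
Take a family `g` built from exponentials of tiny frequency and perturb it to `f i = g i + ∑ j, (a j
* b j ^ q) • e (w i * l j)`, with `l j` close to `Γ` and `‖Φ (l j)‖ > 1`. In the expansion of a
monomial `f ^ α` every frequency is, up to a small error, a subconvex combination of the `l j`.
Unless the combination is trivial, `‖Φ‖ < 1` there and the term dies under `Φ(D)^q`. Trivial
combinations occur only for `α = β`, when all factors choose the same `j`; `b j` is chosen to cancel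
the eigenvalue exactly, and `a j` to prescribe the coefficient. So `Φ(D)^q (f ^ β)` approaches an
arbitrary target while `Φ(D)^q (f ^ α)` tends to 0 for the other `α` (`exists_pow_monomials_mem`). A
Baire argument over all `A` and all basic open sets then makes every non-zero polynomial without
constant term in a generic `f` hypercyclic (`eventually_residual_aeval_hypercyclic`). This also
excludes algebraic relations, whence free generation.

The geometry enters through `norm_lt_one_of_subconvex_combination`: points of `Γ` are extreme in
`conv(Γ ∪ {0})`, so non-trivial subconvex combinations of points of `Γ` leave `Γ`. -/

theorem eventually_mem_of_im_div_nonneg {K : Set ℂ} (hK : Convex ℝ K) {u v p₀ x : ℂ} (hu : u ∈ K)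
    (hv : v ∈ K) (hp₀ : p₀ ∈ K) (huv : u ≠ v) (hx : x ∈ openSegment ℝ u v)
    (h0 : ((p₀ - x) / (v - u)).im ≠ 0) :
    ∀ᶠ p in 𝓝 x, 0 ≤ ((p - x) / (v - u)).im / ((p₀ - x) / (v - u)).im → p ∈ K := by
  obtain ⟨a, b, ha, hb, hab, hxab⟩ := hx
  set ζ₀ := (p₀ - x) / (v - u) with hζ₀
  have hd : v - u ≠ 0 := sub_ne_zero.2 huv.symm
  -- The sign of `((p - x) / (v - u)).im` tells the side of the line `uv` on which `p` lies. In
  -- affine coordinates along `v - u` and `p₀ - x`, the point `p` is `(r p, s p)`; near `x` the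
  -- barycentric weights of `u` and `v` stay positive, so only the sign of `s p` matters.
  let s : ℂ → ℝ := fun p => ((p - x) / (v - u)).im / ζ₀.im
  let r : ℂ → ℝ := fun p => ((p - x) / (v - u)).re - s p * ζ₀.re
  have hs : Continuous s := by fun_prop
  have hr : Continuous r := by fun_prop
  have hsx : s x = 0 := by simp [s]
  have hrx : r x = 0 := by simp [r, hsx]
  have h1 : ∀ᶠ p in 𝓝 x, 0 < (1 - s p) * a - r p :=
    (by fun_prop : Continuous fun p => (1 - s p) * a - r p).continuousAt.eventually
      (lt_mem_nhds (by simpa [hsx, hrx] using ha))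
  have h2 : ∀ᶠ p in 𝓝 x, 0 < (1 - s p) * b + r p :=
    (by fun_prop : Continuous fun p => (1 - s p) * b + r p).continuousAt.eventually
      (lt_mem_nhds (by simpa [hsx, hrx] using hb))
  filter_upwards [h1, h2] with p hp1 hp2 hp
  have hζ : (p - x) / (v - u) = (r p : ℂ) + s p * ζ₀ := by
    apply Complex.ext
    · simp [r]
    · have : s p * ζ₀.im = ((p - x) / (v - u)).im := div_mul_cancel₀ _ h0
      simp [this]
  have hp' : p = ((1 - s p) * a - r p) • u + ((1 - s p) * b + r p) • v + s p • p₀ := by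
    have e1 : p - x = (r p : ℂ) * (v - u) + s p * (p₀ - x) := by
      have := congrArg (· * (v - u)) hζ
      simp only [div_mul_cancel₀ _ hd, add_mul, hζ₀, mul_assoc] at this
      exact this
    have e2 : (a : ℂ) + b = 1 := by exact_mod_cast hab
    simp only [Complex.real_smul] at hxab ⊢
    push_cast
    linear_combination e1 - (1 - s p : ℂ) * hxab
  rw [hp']
  have := hK.sum_mem (t := Finset.univ)
    (w := ![(1 - s p) * a - r p, (1 - s p) * b + r p, s p]) (z := ![u, v, p₀])
    (by intro i _; fin_cases i; exacts [hp1.le, hp2.le, hp])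
    (by simp [Fin.sum_univ_three]; linear_combination (1 - s p) * hab)
    (by intro i _; fin_cases i; exacts [hu, hv, hp₀])
  simpa [Fin.sum_univ_three] using this

theorem mem_interior_of_im_div_pos {K : Set ℂ} (hK : Convex ℝ K) {u v p₀ x : ℂ} (hu : u ∈ K)
    (hv : v ∈ K) (hp₀ : p₀ ∈ K) (huv : u ≠ v) (hx : x ∈ openSegment ℝ u v)
    (h0 : ((p₀ - x) / (v - u)).im ≠ 0) :
    ∀ᶠ p in 𝓝 x, 0 < ((p - x) / (v - u)).im / ((p₀ - x) / (v - u)).im → p ∈ interior K := by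
  filter_upwards [(eventually_mem_of_im_div_nonneg hK hu hv hp₀ huv hx h0).eventually_nhds]
    with p hp hpos
  rw [mem_interior_iff_mem_nhds]
  have : ∀ᶠ y in 𝓝 p, 0 < ((y - x) / (v - u)).im / ((p₀ - x) / (v - u)).im :=
    (by fun_prop : Continuous fun y => ((y - x) / (v - u)).im
      / ((p₀ - x) / (v - u)).im).continuousAt.eventually (lt_mem_nhds hpos)
  filter_upwards [hp, this] with y hy hy'
  exact hy hy'.le

/-- The triangles with base `uv` and apexes `p₀`, `p₁` on opposite sides together cover a
neighbourhood of `x`. -/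
theorem mem_interior_of_im_div_neg {K : Set ℂ} (hK : Convex ℝ K) {u v p₀ p₁ x : ℂ} (hu : u ∈ K)
    (hv : v ∈ K) (hp₀ : p₀ ∈ K) (hp₁ : p₁ ∈ K) (huv : u ≠ v) (hx : x ∈ openSegment ℝ u v)
    (h0 : 0 < ((p₀ - x) / (v - u)).im) (h1 : ((p₁ - x) / (v - u)).im < 0) :
    x ∈ interior K := by
  rw [mem_interior_iff_mem_nhds]
  filter_upwards [eventually_mem_of_im_div_nonneg hK hu hv hp₀ huv hx h0.ne',
    eventually_mem_of_im_div_nonneg hK hu hv hp₁ huv hx h1.ne] with y hy0 hy1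
  rcases le_total 0 ((y - x) / (v - u)).im with h | h
  · exact hy0 (div_nonneg h h0.le)
  · exact hy1 (div_nonneg_of_nonpos h h1.le)

/-- Of three collinear points of `Γ`, the middle one would lie on the segment joining the other two.
-/
theorem IsStrictlyConvexArc.finite_inter_line {Γ : Set ℂ} (hΓ : IsStrictlyConvexArc Γ) (x d : ℂ)
    (hd : d ≠ 0) : (Γ ∩ {p | ((p - x) / d).im = 0}).Finite := by
  by_contra hinf
  have hreal : ∀ p ∈ Γ ∩ {p | ((p - x) / d).im = 0}, p = x + (((p - x) / d).re : ℂ) * d := by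
    rintro p ⟨-, hp⟩
    have : (((p - x) / d).re : ℂ) = (p - x) / d := Complex.ext (by simp) (by simpa using hp.symm)
    rw [this, div_mul_cancel₀ _ hd]
    ring
  set S := (fun p : ℂ => ((p - x) / d).re) '' (Γ ∩ {p | ((p - x) / d).im = 0}) with hS
  have hSinf : S.Infinite := by
    refine Set.Infinite.image (fun p hp q hq hpq => ?_) hinf
    rw [hreal p hp, hreal q hq]
    rw [show ((p - x) / d).re = ((q - x) / d).re from hpq]
  obtain ⟨t, htS, htc⟩ := hSinf.exists_subset_card_eq 3
  have hmem : ∀ i, ((t.orderEmbOfFin htc i : ℝ)) ∈ S := fun i =>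
    htS (Finset.orderEmbOfFin_mem t htc i)
  have hΓS : ∀ y ∈ S, x + (y : ℂ) * d ∈ Γ := by
    rintro _ ⟨p, hp, rfl⟩
    rw [← hreal p hp]
    exact hp.1
  have h01 : t.orderEmbOfFin htc 0 < t.orderEmbOfFin htc 1 := by simp
  have h12 : t.orderEmbOfFin htc 1 < t.orderEmbOfFin htc 2 := by simp
  generalize ha : t.orderEmbOfFin htc 0 = a at *
  generalize hb : t.orderEmbOfFin htc 1 = b at *
  generalize hc : t.orderEmbOfFin htc 2 = c at *
  have hseg : x + (b : ℂ) * d ∈ segment ℝ (x + (a : ℂ) * d) (x + (c : ℂ) * d) := by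
    have hca : c - a ≠ 0 := by linarith
    refine ⟨(c - b) / (c - a), (b - a) / (c - a), div_nonneg (by linarith) (by linarith),
      div_nonneg (by linarith) (by linarith), by field_simp; ring, ?_⟩
    have hca' : (c : ℂ) - a ≠ 0 := by exact_mod_cast hca
    simp only [Complex.real_smul]
    push_cast
    field_simp
    ring
  have := hΓ _ (hΓS a (ha ▸ hmem 0)) _ (hΓS c (hc ▸ hmem 2)) ⟨hseg, hΓS b (hb ▸ hmem 1)⟩
  simp only [Set.mem_insert_iff, Set.mem_singleton_iff, add_right_inj, mul_eq_mul_right_iff, hd,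
    or_false, Complex.ofReal_inj] at this
  rcases this with h | h <;> linarith

/-- By connectedness, the distance to `x` takes on `Γ` all values between 0 and some positive
number. -/
theorem IsCompactArc.accPt {Γ : Set ℂ} (hΓ : IsCompactArc Γ) (hnt : Γ.Nontrivial) {x : ℂ}
    (hx : x ∈ Γ) : AccPt x (𝓟 Γ) := by
  have hconn : IsPreconnected Γ := by
    obtain ⟨γ, hγ, rfl⟩ := hΓ
    exact isPreconnected_Icc.image γ hγ
  rw [accPt_iff_nhds]
  intro U hU
  obtain ⟨y, hy, hyx⟩ := hnt.exists_ne x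
  obtain ⟨r, hr, hrU⟩ := Metric.mem_nhds_iff.1 hU
  have hImg : IsPreconnected ((fun z => dist z x) '' Γ) :=
    hconn.image _ (by fun_prop)
  have hρ : min (r / 2) (dist y x) ∈ (fun z => dist z x) '' Γ :=
    hImg.ordConnected.out ⟨x, hx, by simp⟩ ⟨y, hy, rfl⟩
      ⟨le_min (by positivity) dist_nonneg, min_le_right _ _⟩
  obtain ⟨z, hz, hzr⟩ := hρ
  have hpos : 0 < dist z x := by
    simp only [hzr]
    exact lt_min (by positivity) (dist_pos.2 hyx)
  refine ⟨z, ⟨hrU ?_, hz⟩, dist_pos.1 hpos⟩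
  rw [Metric.mem_ball]
  simp only at hzr
  rw [hzr]
  exact (min_le_left _ _).trans_lt (by linarith)

/-- Points of a strictly convex arc on the boundary of a convex set containing it are extreme. -/
theorem IsStrictlyConvexArc.mem_extremePoints {Γ K : Set ℂ} (hΓ : IsStrictlyConvexArc Γ)
    (harc : IsCompactArc Γ) (hnt : Γ.Nontrivial) (hK : Convex ℝ K) (hΓK : Γ ⊆ K)
    (hint : ∀ x ∈ Γ, x ∉ interior K) {x : ℂ} (hx : x ∈ Γ) : x ∈ K.extremePoints ℝ := by
  rw [mem_extremePoints_iff_left]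
  refine ⟨hΓK hx, fun u hu v hv hxuv => ?_⟩
  by_contra hux
  have huv : u ≠ v := by
    rintro rfl
    rw [openSegment_same] at hxuv
    exact hux hxuv.symm
  have hd : v - u ≠ 0 := sub_ne_zero.2 huv.symm
  have hfin := hΓ.finite_inter_line x (v - u) hd
  -- Since `x` is an accumulation point of `Γ` and the line `uv` carries only finitely many points
  -- of `Γ`, there are points of `Γ` off this line arbitrarily close to `x`.
  have hfreq : ∃ᶠ p in 𝓝 x, p ∈ Γ ∧ ((p - x) / (v - u)).im ≠ 0 := by
    have h1 := accPt_iff_frequently_nhdsNE.1 (harc.accPt hnt hx)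
    have h2 : ∀ᶠ p in 𝓝[≠] x, p ∉ (Γ ∩ {p | ((p - x) / (v - u)).im = 0}) \ {x} := by
      refine eventually_nhdsWithin_of_eventually_nhds ?_
      exact (hfin.subset Set.sdiff_subset).isClosed.isOpen_compl.mem_nhds (by simp)
    have h3 := (h1.and_eventually (h2.and eventually_mem_nhdsWithin)).filter_mono
      nhdsWithin_le_nhds
    refine h3.mono fun p hp => ⟨hp.1, fun h0 => hp.2.1 ⟨⟨hp.1, h0⟩, hp.2.2⟩⟩
  obtain ⟨p₀, hp₀, h0⟩ := hfreq.exists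
  obtain ⟨p, ⟨hp, hp1⟩, hp2⟩ := (hfreq.and_eventually
    (mem_interior_of_im_div_pos hK hu hv (hΓK hp₀) huv hxuv h0)).exists
  -- Same side of the line: `p` is interior to `K`. Opposite sides: `x` is. Neither is allowed for
  -- points of `Γ`.
  rcases lt_or_gt_of_ne hp1 with h | h <;> rcases lt_or_gt_of_ne h0 with h' | h'
  · exact hint p hp (hp2 (div_pos_of_neg_of_neg h h'))
  · exact hint x hx (mem_interior_of_im_div_neg hK hu hv (hΓK hp₀) (hΓK hp) huv hxuv h' h)
  · exact hint x hx (mem_interior_of_im_div_neg hK hu hv (hΓK hp) (hΓK hp₀) huv hxuv h h')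
  · exact hint p hp (hp2 (div_pos h h'))

theorem Convex.sum_mem_of_sum_le_one {E J : Type*} [AddCommGroup E] [Module ℝ E] [Fintype J]
    {K : Set E} (hK : Convex ℝ K) (h0 : 0 ∈ K) {t : J → ℝ} (ht : ∀ j, 0 ≤ t j)
    (ht1 : ∑ j, t j ≤ 1) {z : J → E} (hz : ∀ j, z j ∈ K) : ∑ j, t j • z j ∈ K := by
  have := hK.sum_mem (t := Finset.univ) (w := fun o : Option J => o.elim (1 - ∑ j, t j) t)
    (z := fun o : Option J => o.elim 0 z)
    (by rintro (_ | j) _ <;> simp [ht, ht1]) (by simp [Fintype.sum_option])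
    (by rintro (_ | j) _ <;> simp [hz, h0])
  simpa [Fintype.sum_option] using this

/-- A subconvex combination of finitely many extreme points is not an extreme point, except for
the trivial combinations. -/
theorem sum_smul_notMem_of_extremePoints {E J : Type*} [AddCommGroup E] [Module ℝ E] [Fintype J]
    [DecidableEq J] {K S : Set E} (hK : Convex ℝ K) (h0 : 0 ∈ K) (hS : S ⊆ K.extremePoints ℝ)
    (h0S : 0 ∉ S) {z : J → E} (hz : ∀ j, z j ∈ S) (hinj : Function.Injective z) {t : J → ℝ}
    (ht : ∀ j, 0 ≤ t j) (ht1 : ∑ j, t j ≤ 1) (hts : ∀ j, t ≠ Pi.single j 1) :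
    ∑ j, t j • z j ∉ S := by
  intro hx
  set x := ∑ j, t j • z j with hxdef
  have key : ∀ j, 0 < t j → z j = x ∧ ∃ y ∈ K, y = x ∧
      (1 - t j) • y = ∑ i ∈ Finset.univ.erase j, t i • z i := by
    intro j hj
    have hsum : t j + ∑ i ∈ Finset.univ.erase j, t i = ∑ i, t i :=
      Finset.add_sum_erase _ _ (Finset.mem_univ j)
    have hj1 : t j < 1 := by
      refine lt_of_le_of_ne ?_ fun h => hts j ?_
      · linarith [Finset.sum_nonneg fun i (_ : i ∈ Finset.univ.erase j) => ht i]
      · have hz' : ∑ i ∈ Finset.univ.erase j, t i = 0 :=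
          le_antisymm (by linarith) (Finset.sum_nonneg fun i _ => ht i)
        rw [Finset.sum_eq_zero_iff_of_nonneg fun i _ => ht i] at hz'
        ext i
        by_cases hij : i = j
        · simp [hij, h]
        · simp [hij, hz' i (by simp [hij])]
    -- The remaining terms, rescaled by `1 / (1 - t j)`, still have total weight at most 1, so they
    -- define a point of `K`, and `x` lies strictly between it and `z j`. Extremality forces both to
    -- equal `x`.
    set t' : J → ℝ := fun i => if i = j then 0 else t i / (1 - t j) with ht'
    have h1 : 0 < 1 - t j := by linarith
    have hy : ∑ i, t' i • z i ∈ K := by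
      refine hK.sum_mem_of_sum_le_one h0 (fun i => ?_) ?_ fun i => (hS (hz i)).1
      · simp only [ht']
        split_ifs
        exacts [le_rfl, div_nonneg (ht i) h1.le]
      · have : ∑ i, t' i = (∑ i ∈ Finset.univ.erase j, t i) / (1 - t j) := by
          rw [Finset.sum_div, ← Finset.add_sum_erase _ t' (Finset.mem_univ j)]
          simp only [ht', if_true, zero_add]
          exact Finset.sum_congr rfl fun i hi => if_neg (Finset.ne_of_mem_erase hi)
        rw [this, div_le_one h1]
        linarith
    have hye : (1 - t j) • ∑ i, t' i • z i = ∑ i ∈ Finset.univ.erase j, t i • z i := by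
      rw [← Finset.add_sum_erase _ (fun i => t' i • z i) (Finset.mem_univ j), smul_add,
        Finset.smul_sum]
      simp only [ht', if_true, zero_smul, smul_zero, zero_add]
      refine Finset.sum_congr rfl fun i hi => ?_
      rw [if_neg (Finset.ne_of_mem_erase hi), smul_smul, mul_div_cancel₀ _ h1.ne']
    have hseg : x ∈ openSegment ℝ (z j) (∑ i, t' i • z i) := by
      refine ⟨t j, 1 - t j, hj, h1, by ring, ?_⟩
      rw [hye, hxdef]
      exact Finset.add_sum_erase _ (fun i => t i • z i) (Finset.mem_univ j)
    have := (mem_extremePoints.1 (hS hx)).2 _ (hS (hz j)).1 _ hy hseg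
    exact ⟨this.1, _, hy, this.2, hye⟩
  by_cases hpos : ∃ j, 0 < t j
  · obtain ⟨j, hj⟩ := hpos
    obtain ⟨hzj, y, -, hyx, hye⟩ := key j hj
    have hzero : ∀ i, i ≠ j → t i = 0 := by
      intro i hij
      by_contra hi
      exact hij (hinj ((key i (lt_of_le_of_ne (ht i) (Ne.symm hi))).1.trans hzj.symm))
    have h2 : ∑ i ∈ Finset.univ.erase j, t i • z i = 0 :=
      Finset.sum_eq_zero fun i hi => by rw [hzero i (Finset.ne_of_mem_erase hi), zero_smul]
    rw [h2, smul_eq_zero, hyx] at hye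
    rcases hye with h | h
    · refine hts j ?_
      ext i
      by_cases hij : i = j
      · subst hij
        simp
        linarith
      · simp [hij, hzero i hij]
    · exact h0S (h ▸ hx)
  · push Not at hpos
    have hx0 : x = 0 := Finset.sum_eq_zero fun i _ => by
      rw [le_antisymm (hpos i) (ht i), zero_smul]
    exact h0S (hx0 ▸ hx)

/-- A non-constant entire function takes values of larger modulus near every point. -/
theorem frequently_norm_lt {Φ : ℂ → ℂ} (hΦ : Differentiable ℂ Φ) {a x : ℂ} (ha : Φ a ≠ Φ x) :
    ∃ᶠ z in 𝓝 x, ‖Φ x‖ < ‖Φ z‖ := by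
  intro h
  have hmax : IsLocalMax (norm ∘ Φ) x := by
    filter_upwards [h] with z hz
    exact not_lt.1 hz
  have hev := Complex.eventually_eq_of_isLocalMax_norm
    (Eventually.of_forall fun z => hΦ z) hmax
  have := (hΦ.differentiableOn.analyticOnNhd isOpen_univ).eqOn_of_preconnected_of_eventuallyEq
    (analyticOnNhd_const (v := Φ x)) isPreconnected_univ (Set.mem_univ x) hev
  exact ha (this (Set.mem_univ a))

theorem norm_lt_one_of_subconvex_combination {Φ : ℂ → ℂ} (hΦ : Differentiable ℂ Φ)
    (hΦ0 : ‖Φ 0‖ < 1) {Γ : Set ℂ} (hΓ : IsCompactArc Γ) (hnt : Γ.Nontrivial)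
    (hΓconvex : IsStrictlyConvexArc Γ) (hΓlevel : Γ ⊆ {z | ‖Φ z‖ = 1})
    (hconv : convexHull ℝ (Γ ∪ {0}) \ Γ ⊆ {z | ‖Φ z‖ < 1}) {J : Type*} [Fintype J]
    [DecidableEq J] {γ : J → ℂ} (hγ : ∀ j, γ j ∈ Γ) (hinj : Function.Injective γ) {t : J → ℝ}
    (ht : ∀ j, 0 ≤ t j) (ht1 : ∑ j, t j ≤ 1) (hts : ∀ j, t ≠ Pi.single j 1) :
    ‖Φ (∑ j, t j • γ j)‖ < 1 := by
  set K := convexHull ℝ (Γ ∪ {0}) with hK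
  have hΓK : Γ ⊆ K := Set.subset_union_left.trans (subset_convexHull ℝ _)
  have h0K : (0 : ℂ) ∈ K := subset_convexHull ℝ _ (by simp)
  have hKc : Convex ℝ K := convex_convexHull ℝ _
  have h0Γ : (0 : ℂ) ∉ Γ := fun h => hΦ0.ne (hΓlevel h)
  -- On the hull `‖Φ‖ ≤ 1`, whereas the maximum principle gives points with `‖Φ‖ > 1` arbitrarily
  -- near each point of `Γ`.
  have hint : ∀ x ∈ Γ, x ∉ interior K := by
    intro x hx hxi
    have hne : Φ 0 ≠ Φ x := fun h => hΦ0.ne (h ▸ hΓlevel hx)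
    obtain ⟨z, hz1, hz2⟩ := ((frequently_norm_lt hΦ hne).and_eventually
      (mem_interior_iff_mem_nhds.1 hxi)).exists
    rw [hΓlevel hx] at hz1
    by_cases hzΓ : z ∈ Γ
    · exact hz1.ne' (hΓlevel hzΓ)
    · exact lt_asymm hz1 (hconv ⟨hz2, hzΓ⟩)
  refine hconv ⟨hKc.sum_mem_of_sum_le_one h0K ht ht1 fun j => hΓK (hγ j), ?_⟩
  exact sum_smul_notMem_of_extremePoints hKc h0K
    (fun x hx => hΓconvex.mem_extremePoints hΓ hnt hKc hΓK hint hx) h0Γ hγ hinj ht ht1 hts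

/-! ### Topology of the space of entire functions -/

section EntireFunctions

noncomputable local instance : Ring entireFunctions := entireFunctions.toRing

noncomputable local instance : AddCommGroup entireFunctions :=
  entireFunctions.toRing.toAddCommGroup

noncomputable local instance : AddGroup entireFunctions :=
  entireFunctions.toRing.toAddCommGroup.toAddGroup

noncomputable local instance : SubNegMonoid entireFunctions :=
  entireFunctions.toRing.toAddCommGroup.toAddGroup.toSubNegMonoid

noncomputable local instance : Sub entireFunctions :=
  entireFunctions.toRing.toAddCommGroup.toAddGroup.toSubNegMonoid.toSub

instance : IsTopologicalSemiring entireFunctions := inferInstance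

instance : ContinuousNeg entireFunctions where
  continuous_neg := (continuous_neg.comp continuous_subtype_val).subtype_mk _

instance : IsTopologicalRing entireFunctions where

instance : IsTopologicalAddGroup entireFunctions where

instance : SecondCountableTopology entireFunctions :=
  Topology.IsInducing.subtypeVal.secondCountableTopology

theorem isClosed_entireFunctions : IsClosed (entireFunctions : Set C(ℂ, ℂ)) := by
  refine IsSeqClosed.isClosed fun F g hF hg => ?_
  have h := tendstoLocallyUniformlyOn_univ.2
    (ContinuousMap.tendsto_iff_tendstoLocallyUniformly.1 hg)
  exact differentiableOn_univ.1 (h.differentiableOn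
    (Eventually.of_forall fun n => Differentiable.differentiableOn (hF n)) isOpen_univ)

instance : TopologicalSpace.IsCompletelyMetrizableSpace entireFunctions :=
  isClosed_entireFunctions.isCompletelyMetrizableSpace

theorem tendsto_entireFunctions_iff {α : Type*} {l : Filter α} {F : α → entireFunctions}
    {f : entireFunctions} : Tendsto F l (𝓝 f) ↔
      ∀ r : ℝ, TendstoUniformlyOn (fun i z => (F i).1 z) f.1 l (Metric.closedBall 0 r) := by
  rw [Topology.IsInducing.subtypeVal.tendsto_nhds_iff,
    ContinuousMap.tendsto_iff_forall_isCompact_tendstoUniformlyOn]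
  constructor
  · intro h r
    exact h _ (isCompact_closedBall 0 r)
  · intro h K hK
    obtain ⟨r, hr⟩ := hK.isBounded.subset_closedBall 0
    exact (h r).mono hr

theorem tendsto_entireFunctions_of_norm_le {α : Type*} {l : Filter α} {F : α → entireFunctions}
    {f : entireFunctions}
    (h : ∀ r : ℝ, 0 ≤ r → ∃ b : α → ℝ, Tendsto b l (𝓝 0) ∧
      ∀ᶠ i in l, ∀ z : ℂ, ‖z‖ ≤ r → ‖(F i).1 z - f.1 z‖ ≤ b i) : Tendsto F l (𝓝 f) := by
  refine tendsto_entireFunctions_iff.2 fun r => ?_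
  rcases lt_or_ge r 0 with hr | hr
  · rw [Metric.closedBall_eq_empty.2 hr]
    exact tendstoUniformlyOn_empty
  obtain ⟨b, hb, hF⟩ := h r hr
  rw [Metric.tendstoUniformlyOn_iff]
  intro ε hε
  filter_upwards [hF, hb.eventually (gt_mem_nhds hε)] with i hi hbi z hz
  rw [dist_comm, dist_eq_norm]
  exact (hi z (by simpa using hz)).trans_lt hbi

/-! ### Convolution operators -/

/-- The convolution operator as a linear map. -/
noncomputable def convolutionLinearMap {Φ : ℂ → ℂ} (hΦ : IsEntireOfExponentialType Φ) :
    entireFunctions →ₗ[ℂ] entireFunctions where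
  toFun := convolutionOperator Φ
  map_add' f g := by
    refine (hasSum_convolutionOperator hΦ (f + g)).unique ?_
    simpa only [map_add, smul_add] using
      (hasSum_convolutionOperator hΦ f).add (hasSum_convolutionOperator hΦ g)
  map_smul' c f := by
    refine (hasSum_convolutionOperator hΦ (c • f)).unique ?_
    have := (hasSum_convolutionOperator hΦ f).const_smul c
    simp only [map_smul, RingHom.id_apply]
    convert! this using 2 with n
    rw [smul_comm]

/-- Cauchy's estimates on circles of radius `2 * R` beat the growth `R ^ n / n!` of the coefficients
by `2⁻ⁿ`. The bound depends on `f` only through its supremum on a larger disc, which gives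
continuity. -/
theorem exists_norm_convolutionOperator_le {Φ : ℂ → ℂ} (hΦ : IsEntireOfExponentialType Φ) :
    ∃ A ρ : ℝ, 0 < A ∧ ∀ (f : entireFunctions) (r C : ℝ),
      (∀ z : ℂ, ‖z‖ ≤ r + ρ → ‖f.1 z‖ ≤ C) →
        ∀ z : ℂ, ‖z‖ ≤ r → ‖(convolutionOperator Φ f).1 z‖ ≤ A * C := by
  have hsum := hasSum_convolutionOperator hΦ
  obtain ⟨-, M, R, hM, hR, ha⟩ := hΦ
  refine ⟨M * 2, 2 * R, by positivity, fun f r C hC z hz => ?_⟩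
  have hev : HasSum (fun n => taylorCoeffZero Φ n * iteratedDeriv n f.1 z)
      ((convolutionOperator Φ f).1 z) := by
    have hcont : Continuous fun g : entireFunctions => g.1 z :=
      (continuous_eval_const z).comp continuous_subtype_val
    have := (hsum f).map (AddMonoidHom.mk' (fun g : entireFunctions => g.1 z) fun _ _ => rfl) hcont
    convert! this using 2 with n
    simp only [Function.comp_apply, AddMonoidHom.mk'_apply]
    rw [← entireDeriv_pow_apply]
    rfl
  have hbound : ∀ n, ‖taylorCoeffZero Φ n * iteratedDeriv n f.1 z‖ ≤ M * C * (1 / 2 : ℝ) ^ n := by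
    intro n
    have hx : ‖iteratedDeriv n f.1 z‖ ≤ n.factorial * C / (2 * R) ^ n := by
      refine Complex.norm_iteratedDeriv_le_of_forall_mem_sphere_norm_le n (by positivity)
        (f.2 : Differentiable ℂ f.1).diffContOnCl fun w hw => hC w ?_
      have : ‖w - z‖ = 2 * R := by simpa using hw
      calc ‖w‖ = ‖z + (w - z)‖ := by ring_nf
        _ ≤ ‖z‖ + ‖w - z‖ := norm_add_le _ _
        _ ≤ r + 2 * R := by rw [this]; gcongr
    rw [norm_mul]
    calc _ ≤ (M * R ^ n / (n.factorial : ℝ)) * (n.factorial * C / (2 * R) ^ n) :=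
          mul_le_mul (ha n) hx (norm_nonneg _) (by positivity)
      _ = M * C * (1 / 2 : ℝ) ^ n := by
          have hn : (n.factorial : ℝ) ≠ 0 := by positivity
          rw [mul_pow, div_pow, one_pow]
          field_simp
  rw [← hev.tsum_eq]
  refine (tsum_of_norm_bounded (hasSum_geometric_two.mul_left _) hbound).trans (le_of_eq ?_)
  ring

theorem continuous_convolutionOperator {Φ : ℂ → ℂ} (hΦ : IsEntireOfExponentialType Φ) :
    Continuous (convolutionOperator Φ) := by
  obtain ⟨A, ρ, hA, h⟩ := exists_norm_convolutionOperator_le hΦ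
  refine continuous_iff_continuousAt.2 fun f => tendsto_entireFunctions_iff.2 fun r => ?_
  have hid := tendsto_entireFunctions_iff.1 (tendsto_id (x := 𝓝 f)) (r + ρ)
  rw [Metric.tendstoUniformlyOn_iff] at hid ⊢
  intro ε hε
  filter_upwards [hid (ε / (2 * A)) (by positivity)] with g hg z hz
  have hlin : convolutionOperator Φ (f - g) = convolutionOperator Φ f - convolutionOperator Φ g :=
    map_sub (convolutionLinearMap hΦ) f g
  have := h (f - g) r (ε / (2 * A)) (fun w hw => ?_) z (by simpa using hz)
  · rw [hlin] at this
    rw [dist_eq_norm]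
    refine this.trans_lt ?_
    rw [show A * (ε / (2 * A)) = ε / 2 by field_simp]
    linarith
  · have := hg w (by simpa using hw)
    rw [dist_eq_norm] at this
    exact this.le

/-! ### Exponentials -/

/-- The entire function `z ↦ exp (a z)`. -/
noncomputable def expEntire (a : ℂ) : entireFunctions :=
  ⟨⟨fun z => Complex.exp (a * z), by fun_prop⟩,
    (by fun_prop : Differentiable ℂ fun z : ℂ => Complex.exp (a * z))⟩

/-- The identity as an entire function. -/
def idEntire : entireFunctions := ⟨⟨fun z => z, continuous_id⟩, differentiable_id⟩

theorem expEntire_zero : expEntire 0 = 1 := by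
  ext z
  change Complex.exp (0 * z) = 1
  simp

theorem expEntire_add (a b : ℂ) : expEntire (a + b) = expEntire a * expEntire b := by
  ext z
  change Complex.exp ((a + b) * z) = Complex.exp (a * z) * Complex.exp (b * z)
  rw [add_mul, Complex.exp_add]

theorem entireDeriv_expEntire (a : ℂ) : entireDeriv (expEntire a) = a • expEntire a := by
  ext z
  change deriv (fun z => Complex.exp (a * z)) z = a * Complex.exp (a * z)
  have : HasDerivAt (fun z => Complex.exp (a * z)) (Complex.exp (a * z) * (a * 1)) z :=
    ((hasDerivAt_id z).const_mul a).cexp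
  rw [this.deriv]
  ring

theorem entireDeriv_pow_expEntire (a : ℂ) (n : ℕ) :
    (entireDeriv ^ n) (expEntire a) = a ^ n • expEntire a := by
  induction n with
  | zero => simp
  | succ n ih =>
    rw [pow_succ, Module.End.mul_apply, entireDeriv_expEntire, map_smul, ih, smul_smul, pow_succ']

theorem convolutionOperator_expEntire {Φ : ℂ → ℂ} (hΦ : IsEntireOfExponentialType Φ) (a : ℂ) :
    convolutionOperator Φ (expEntire a) = Φ a • expEntire a := by
  refine (hasSum_convolutionOperator hΦ _).unique ?_
  have h := (Complex.hasSum_taylorSeries_of_entire hΦ.1 0 a).smul_const (expEntire a)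
  convert! h using 2 with n
  rw [entireDeriv_pow_expEntire, smul_smul, taylorCoeffZero, sub_zero]
  congr 1
  simp only [smul_eq_mul]
  ring

/-- Divided differences of the exponential family converge to its derivatives. -/
theorem tendsto_dividedDifference_expEntire (a : ℂ) (n : ℕ) :
    Tendsto (fun b : ℂ => (n.factorial / (b - a) ^ n : ℂ) • (expEntire b -
      ∑ m ∈ Finset.range n, ((b - a) ^ m / m.factorial : ℂ) • (idEntire ^ m * expEntire a)))
      (𝓝[≠] a) (𝓝 (idEntire ^ n * expEntire a)) := by
  refine tendsto_entireFunctions_of_norm_le fun r hr => ?_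
  refine ⟨fun b => ‖b - a‖ * (n.factorial * r ^ (n + 1) * Real.exp ((1 + ‖a‖) * r)), ?_, ?_⟩
  · have : Continuous fun b : ℂ =>
      ‖b - a‖ * (n.factorial * r ^ (n + 1) * Real.exp ((1 + ‖a‖) * r)) := by fun_prop
    have := this.tendsto a
    simp only [sub_self, norm_zero, zero_mul] at this
    exact this.mono_left nhdsWithin_le_nhds
  have hnear : ∀ᶠ b in 𝓝[≠] a, ‖b - a‖ ≤ 1 := by
    filter_upwards [nhdsWithin_le_nhds (Metric.closedBall_mem_nhds a one_pos)] with b hb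
    simpa [dist_eq_norm] using hb
  filter_upwards [hnear, eventually_mem_nhdsWithin] with b hb hba z hz
  have hba' : b - a ≠ 0 := sub_ne_zero.2 hba
  set h := b - a with hh
  have hval : ((n.factorial / h ^ n : ℂ) • (expEntire b -
      ∑ m ∈ Finset.range n, (h ^ m / m.factorial : ℂ) • (idEntire ^ m * expEntire a))).1 z -
      (idEntire ^ n * expEntire a).1 z = (n.factorial / h ^ n : ℂ) * Complex.exp (a * z) *
        (Complex.exp (h * z) - ∑ m ∈ Finset.range (n + 1), (h * z) ^ m / m.factorial) := by
    have e1 : (∑ m ∈ Finset.range n, (h ^ m / m.factorial : ℂ) • (idEntire ^ m * expEntire a)).1 z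
        = ∑ m ∈ Finset.range n, (h ^ m / m.factorial : ℂ) * (z ^ m * Complex.exp (a * z)) := by
      have := map_sum (AddMonoidHom.mk' (fun g : entireFunctions => g.1 z) fun _ _ => rfl)
        (fun m => (h ^ m / m.factorial : ℂ) • (idEntire ^ m * expEntire a)) (Finset.range n)
      simp only [AddMonoidHom.mk'_apply] at this
      exact this
    have e2 : Complex.exp (b * z) = Complex.exp (a * z) * Complex.exp (h * z) := by
      rw [← Complex.exp_add, hh]
      ring_nf
    change (n.factorial / h ^ n : ℂ) * (Complex.exp (b * z) -
      (∑ m ∈ Finset.range n, (h ^ m / m.factorial : ℂ) • (idEntire ^ m * expEntire a)).1 z) -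
      z ^ n * Complex.exp (a * z) = _
    have e3 : ∑ m ∈ Finset.range n, (h ^ m / m.factorial : ℂ) * (z ^ m * Complex.exp (a * z))
        = Complex.exp (a * z) * ∑ m ∈ Finset.range n, (h * z) ^ m / m.factorial := by
      rw [Finset.mul_sum]
      refine Finset.sum_congr rfl fun m _ => ?_
      rw [mul_pow]
      ring
    have hf : (n.factorial : ℂ) ≠ 0 := by exact_mod_cast n.factorial_ne_zero
    have hhn : h ^ n ≠ 0 := pow_ne_zero _ hba'
    rw [e1, e2, e3, Finset.sum_range_succ, mul_pow]
    field_simp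
    ring
  rw [hval, norm_mul, norm_mul, norm_div, norm_pow, Complex.norm_natCast]
  have hhpos : 0 < ‖h‖ := norm_pos_iff.2 hba'
  have h1 : ‖Complex.exp (a * z)‖ ≤ Real.exp (‖a‖ * r) := by
    rw [Complex.norm_exp]
    refine Real.exp_le_exp.2 ((Complex.re_le_norm _).trans ?_)
    rw [norm_mul]
    gcongr
  have h2 : ‖Complex.exp (h * z) - ∑ m ∈ Finset.range (n + 1), (h * z) ^ m / m.factorial‖ ≤
      (‖h‖ ^ (n + 1) * r ^ (n + 1)) * Real.exp (1 * r) := by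
    refine (Complex.norm_exp_sub_sum_le_norm_mul_exp _ _).trans ?_
    rw [norm_mul, mul_pow]
    gcongr
  calc _ ≤ (n.factorial / ‖h‖ ^ n) * Real.exp (‖a‖ * r) *
        ((‖h‖ ^ (n + 1) * r ^ (n + 1)) * Real.exp (1 * r)) := by gcongr
    _ = _ := by
      rw [add_mul, Real.exp_add, pow_succ ‖h‖ n]
      field_simp

theorem continuous_expEntire : Continuous expEntire := by
  refine continuous_iff_continuousAt.2 fun a => continuousAt_iff_punctured_nhds.2 ?_
  simpa using tendsto_dividedDifference_expEntire a 0

theorem hasSum_idEntire_pow (f : entireFunctions) :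
    HasSum (fun n => taylorCoeffZero f.1 n • idEntire ^ n) f := by
  set F : ℕ → entireFunctions := fun n => taylorCoeffZero f.1 n • idEntire ^ n with hF
  have hpt : ∀ z, HasSum (fun n => (F n).1 z) (f.1 z) := by
    intro z
    have h := Complex.hasSum_taylorSeries_of_entire (f.2 : Differentiable ℂ f.1) 0 z
    convert! h using 2 with n
    change taylorCoeffZero f.1 n * z ^ n = _
    rw [taylorCoeffZero, sub_zero]
    simp only [smul_eq_mul]
    ring
  have hsum : Summable fun n => (F n).1 := by
    refine ContinuousMap.summable_of_locally_summable_norm fun K => ?_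
    obtain ⟨r, hr0, hr⟩ := K.isCompact.isBounded.subset_closedBall_lt 0 0
    obtain ⟨C, hC⟩ := (isCompact_closedBall (0 : ℂ) (2 * r)).exists_bound_of_continuousOn
      f.1.continuous.continuousOn
    refine Summable.of_norm_bounded (g := fun n : ℕ => |C| * (1 / 2 : ℝ) ^ n)
      (summable_geometric_two.mul_left _) fun n => ?_
    rw [norm_norm]
    refine (ContinuousMap.norm_le _ (by positivity)).2 fun x => ?_
    have hx : ‖iteratedDeriv n f.1 (0 : ℂ)‖ ≤ n.factorial * |C| / (2 * r) ^ n :=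
      Complex.norm_iteratedDeriv_le_of_forall_mem_sphere_norm_le n (by positivity)
        (f.2 : Differentiable ℂ f.1).diffContOnCl fun z hz =>
          (hC z (Metric.sphere_subset_closedBall hz)).trans (le_abs_self C)
    have hxr : ‖(x : ℂ)‖ ≤ r := by simpa using hr x.2
    change ‖taylorCoeffZero f.1 n * (x : ℂ) ^ n‖ ≤ _
    have hn : (n.factorial : ℝ) ≠ 0 := by positivity
    rw [taylorCoeffZero, norm_mul, norm_div, norm_pow, Complex.norm_natCast]
    calc _ ≤ (n.factorial * |C| / (2 * r) ^ n) / n.factorial * r ^ n := by gcongr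
      _ = _ := by
        rw [mul_pow, div_pow, one_pow]
        field_simp
  obtain ⟨g, hg⟩ := hsum
  have hgf : g = f.1 := by
    ext z
    have := hg.map (AddMonoidHom.mk' (fun g : C(ℂ, ℂ) => g z) fun _ _ => rfl)
      (continuous_eval_const z)
    exact this.unique (hpt z)
  rw [hgf] at hg
  exact (Topology.IsInducing.hasSum_iff (g := entireFunctions.val)
    Topology.IsInducing.subtypeVal F f).1 hg

/-- Divided differences at `a` put every `z ^ n * exp (a z)` into the closed span, by induction on
`n`. Expanding `f * exp (-a z)` in its Taylor series and multiplying back by `exp (a z)` recovers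
any `f`. -/
theorem dense_span_expEntire {Λ : Set ℂ} {a : ℂ} (ha : AccPt a (𝓟 Λ)) :
    Dense (Submodule.span ℂ (expEntire '' Λ) : Set entireFunctions) := by
  set M := (Submodule.span ℂ (expEntire '' Λ)).topologicalClosure with hM
  have hMc : IsClosed (M : Set entireFunctions) := Submodule.isClosed_topologicalClosure _
  have hspan : ∀ b ∈ Λ, expEntire b ∈ M := fun b hb =>
    Submodule.le_topologicalClosure _ (Submodule.subset_span ⟨b, hb, rfl⟩)
  have hmono : ∀ n, idEntire ^ n * expEntire a ∈ M := by
    intro n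
    induction n using Nat.strong_induction_on with
    | _ n ih =>
      have : (𝓝[≠] a ⊓ 𝓟 Λ).NeBot := ha
      refine hMc.mem_of_tendsto
        ((tendsto_dividedDifference_expEntire a n).mono_left (inf_le_left (b := 𝓟 Λ))) ?_
      filter_upwards [mem_inf_of_right (mem_principal_self Λ)] with b hb
      exact M.smul_mem _ (M.sub_mem (hspan b hb)
        (M.sum_mem fun m hm => M.smul_mem _ (ih m (Finset.mem_range.1 hm))))
  intro f
  have hf := (hasSum_idEntire_pow (f * expEntire (-a))).mul_right (expEntire a)
  rw [mul_assoc, ← expEntire_add, neg_add_cancel, expEntire_zero, mul_one] at hf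
  refine hMc.mem_of_tendsto hf (Eventually.of_forall fun s => M.sum_mem fun n _ => ?_)
  rw [smul_mul_assoc]
  exact M.smul_mem _ (hmono n)

end EntireFunctions

/-! ### Products of perturbed families of eigenvectors -/

/-- On a finite set of non-zero exponents some positive weight has a unique maximizer. -/
theorem exists_weight_unique_maximizer {ι : Type*} [Countable ι] {A : Finset (ι →₀ ℕ)}
    (hA : A.Nonempty) (h0 : 0 ∉ A) :
    ∃ β ∈ A, ∃ w : ι → ℝ, (∀ i, 0 < w i) ∧ (β.sum fun i n => n * w i) = 1 ∧
      ∀ α ∈ A, α ≠ β → (α.sum fun i n => n * w i) < 1 := by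
  classical
  obtain ⟨enc, henc⟩ := Countable.exists_injective_nat ι
  -- Weights of the form `x ^ enc i` turn the weight of `α` into the value at `x` of a polynomial
  -- that determines `α`.
  let p : (ι →₀ ℕ) → Polynomial ℝ := fun α => α.sum fun i n => Polynomial.monomial (enc i) (n : ℝ)
  have hcoeff : ∀ α i, (p α).coeff (enc i) = α i := by
    intro α i
    simp only [p, Finsupp.sum, Polynomial.finsetSum_coeff, Polynomial.coeff_monomial, henc.eq_iff]
    rw [Finset.sum_ite_eq' α.support i]
    simp +contextual
  have hp : Function.Injective p := fun α β h => by
    ext i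
    have := congrArg (fun r => r.coeff (enc i)) h
    simpa [hcoeff] using this
  have heval : ∀ α x, (p α).eval x = α.sum fun i n => n * x ^ enc i := by
    intro α x
    simp [p, Finsupp.sum, Polynomial.eval_finsetSum, Polynomial.eval_monomial]
  -- Away from the finitely many roots of `Q`, distinct exponents in `A` have distinct weights.
  -- Dividing by the largest one normalizes it to 1.
  set Q : Polynomial ℝ := ∏ c ∈ A.offDiag, (p c.1 - p c.2) with hQ
  have hQ0 : Q ≠ 0 := Finset.prod_ne_zero_iff.2 fun c hc =>
    sub_ne_zero.2 (hp.ne (Finset.mem_offDiag.1 hc).2.2)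
  obtain ⟨x, hx0, hxQ⟩ : ∃ x ∈ Set.Ioi (0 : ℝ), x ∉ (Q.roots.toFinset : Set ℝ) :=
    (Set.Ioi_infinite (0 : ℝ)).exists_notMem_finset Q.roots.toFinset
  have hx0 : 0 < x := hx0
  have hxQ : Q.eval x ≠ 0 := by simpa [hQ0] using hxQ
  obtain ⟨β, hβ, hmax⟩ := A.exists_max_image (fun α => (p α).eval x) hA
  have hpos : 0 < (p β).eval x := by
    have hβ0 : β ≠ 0 := fun h => h0 (h ▸ hβ)
    rw [heval]
    refine Finset.sum_pos (fun i hi => ?_) (Finsupp.support_nonempty_iff.2 hβ0)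
    have : (0 : ℝ) < β i := by exact_mod_cast Nat.pos_of_ne_zero (Finsupp.mem_support_iff.1 hi)
    positivity
  have hnorm : ∀ α : ι →₀ ℕ, (α.sum fun i n => n * (x ^ enc i / (p β).eval x)) =
      (p α).eval x / (p β).eval x := by
    intro α
    rw [heval α, Finsupp.sum, Finsupp.sum, Finset.sum_div]
    exact Finset.sum_congr rfl fun i _ => by ring
  refine ⟨β, hβ, fun i => x ^ enc i / (p β).eval x, fun i => by positivity, ?_, fun α hα hαβ => ?_⟩
  · rw [hnorm, div_self hpos.ne']
  · rw [hnorm, div_lt_one hpos]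
    refine lt_of_le_of_ne (hmax α hα) fun h => hxQ ?_
    rw [hQ, Polynomial.eval_prod]
    exact Finset.prod_eq_zero (i := (α, β)) (Finset.mem_offDiag.2 ⟨hα, hβ, hαβ⟩) (by simp [h])

section Eigenvectors

variable {X : Type*} [CommRing X] [Algebra ℂ X] {e : ℂ → X}

/-- Frequencies add under multiplication, so the radii of the balls add too. -/
theorem prod_mem_span_closedBall (he0 : e 0 = 1) (hadd : ∀ a b, e (a + b) = e a * e b)
    {Y : Type*} (s : Finset Y) {G : Y → X} {η : ℝ}
    (hG : ∀ y ∈ s, G y ∈ Submodule.span ℂ (e '' Metric.closedBall 0 η)) :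
    ∏ y ∈ s, G y ∈ Submodule.span ℂ (e '' Metric.closedBall 0 (s.card * η)) := by
  induction s using Finset.cons_induction with
  | empty =>
    rw [Finset.prod_empty, ← he0]
    exact Submodule.subset_span ⟨0, by simp, rfl⟩
  | cons y s hy ih =>
    rw [Finset.prod_cons]
    have h1 := Submodule.mul_mem_mul (hG y (Finset.mem_cons_self y s))
      (ih fun z hz => hG z (Finset.mem_cons_of_mem hz))
    rw [Submodule.span_mul_span] at h1
    refine Submodule.span_mono ?_ h1
    rintro _ ⟨_, ⟨a, ha, rfl⟩, _, ⟨b, hb, rfl⟩, rfl⟩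
    refine ⟨a + b, ?_, hadd a b⟩
    rw [mem_closedBall_zero_iff] at *
    rw [Finset.card_cons]
    push_cast
    linarith [norm_add_le a b]

theorem pow_apply_of_eigenvector {T : X →ₗ[ℂ] X} {Φ : ℂ → ℂ} (hT : ∀ a, T (e a) = Φ a • e a)
    (a : ℂ) (q : ℕ) : (T ^ q) (e a) = Φ a ^ q • e a := by
  induction q with
  | zero => simp
  | succ q ih => rw [pow_succ, Module.End.mul_apply, hT, map_smul, ih, smul_smul, pow_succ']

/-- The weight that a choice function `σ` puts on the index `j`. -/
noncomputable def choiceWeight {J Y : Type*} [Fintype Y] [DecidableEq J] (w : Y → ℝ)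
    (σ : Y → Option J) (j : J) : ℝ :=
  ∑ y, if σ y = some j then w y else 0

theorem choiceWeight_nonneg {J Y : Type*} [Fintype Y] [DecidableEq J] {w : Y → ℝ}
    (hw : ∀ y, 0 < w y) (σ : Y → Option J) (j : J) : 0 ≤ choiceWeight w σ j :=
  Finset.sum_nonneg fun y _ => by split_ifs <;> simp [(hw y).le]

theorem sum_choiceWeight_le {J Y : Type*} [Fintype Y] [Fintype J] [DecidableEq J] {w : Y → ℝ}
    (hw : ∀ y, 0 < w y) (σ : Y → Option J) : ∑ j, choiceWeight w σ j ≤ ∑ y, w y := by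
  simp only [choiceWeight]
  rw [Finset.sum_comm]
  refine Finset.sum_le_sum fun y _ => ?_
  cases h : σ y <;> simp [(hw y).le]

theorem eq_const_of_choiceWeight_eq {J Y : Type*} [Fintype Y] [DecidableEq J] {w : Y → ℝ}
    (hw : ∀ y, 0 < w y) {σ : Y → Option J} {j : J} (h : ∑ y, w y ≤ choiceWeight w σ j) :
    σ = fun _ => some j := by
  by_contra hne
  obtain ⟨y, hy⟩ := Function.ne_iff.1 hne
  refine h.not_gt (Finset.sum_lt_sum (fun z _ => ?_) ⟨y, Finset.mem_univ y, ?_⟩)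
  · split_ifs <;> simp [(hw z).le]
  · rw [if_neg hy]
    exact hw y

/-- Expansion of a product of perturbed vectors along the choice functions. -/
theorem prod_perturbed_eq_sum (he0 : e 0 = 1) (hadd : ∀ a b, e (a + b) = e a * e b)
    {J Y : Type*} [Fintype J] [DecidableEq J] [Fintype Y] [DecidableEq Y] (w : Y → ℝ) (g : Y → X)
    (a b l : J → ℂ) (q : ℕ) :
    ∏ y, (g y + ∑ j, (a j * b j ^ q) • e (w y * l j)) =
      ∑ σ : Y → Option J, (∏ y, (σ y).elim 1 a) • (∏ y, (σ y).elim 1 b) ^ q •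
        (e (∑ j, choiceWeight w σ j • l j) * ∏ y, (σ y).elim (g y) 1) := by
  have hsum : ∀ s : Finset Y, ∀ c : Y → ℂ, e (∑ y ∈ s, c y) = ∏ y ∈ s, e (c y) := by
    intro s c
    induction s using Finset.cons_induction with
    | empty => simpa using he0
    | cons x s hx ih => rw [Finset.sum_cons, Finset.prod_cons, hadd, ih]
  have h1 : ∀ y, g y + ∑ j, (a j * b j ^ q) • e (w y * l j) =
      ∑ o : Option J, (o.elim 1 a * o.elim 1 b ^ q) •
        (e (o.elim 0 fun j => w y * l j) * o.elim (g y) 1) := by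
    intro y
    simp [Fintype.sum_option, he0]
  simp only [h1]
  rw [Fintype.prod_sum]
  refine Finset.sum_congr rfl fun σ _ => ?_
  have h2 : ∑ j, choiceWeight w σ j • l j = ∑ y, (σ y).elim 0 fun j => w y * l j := by
    simp only [choiceWeight, Finset.sum_smul]
    rw [Finset.sum_comm]
    refine Finset.sum_congr rfl fun y _ => ?_
    cases σ y <;> simp [ite_smul]
  rw [h2, hsum, Finset.prod_smul, Finset.prod_mul_distrib, Finset.prod_mul_distrib,
    Finset.prod_pow, smul_smul]

variable [TopologicalSpace X] [IsTopologicalRing X] [ContinuousSMul ℂ X]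

/-- On each exponential occurring in `e μ * G` the operator acts as a scalar of modulus below 1, and
the factor `θ ^ q` cannot undo the decay. -/
theorem tendsto_pow_smul_mul_zero (hadd : ∀ a b, e (a + b) = e a * e b) {T : X →ₗ[ℂ] X}
    {Φ : ℂ → ℂ} (hT : ∀ a, T (e a) = Φ a • e a) {θ μ : ℂ} (hθ : ‖θ‖ ≤ 1) {η : ℝ}
    (hμ : ∀ δ ∈ Metric.closedBall (0 : ℂ) η, ‖Φ (μ + δ)‖ < 1) {G : X}
    (hG : G ∈ Submodule.span ℂ (e '' Metric.closedBall 0 η)) :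
    Tendsto (fun q : ℕ => (T ^ q) (θ ^ q • (e μ * G))) atTop (𝓝 0) := by
  induction hG using Submodule.span_induction with
  | mem x hx =>
    obtain ⟨δ, hδ, rfl⟩ := hx
    have h : ∀ q : ℕ, (T ^ q) (θ ^ q • (e μ * e δ)) = (θ * Φ (μ + δ)) ^ q • e (μ + δ) := by
      intro q
      rw [map_smul, ← hadd, pow_apply_of_eigenvector hT, smul_smul, mul_pow]
    simp only [h]
    have hlt : ‖θ * Φ (μ + δ)‖ < 1 := by
      rw [norm_mul]
      exact (mul_le_of_le_one_left (norm_nonneg _) hθ).trans_lt (hμ δ hδ)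
    simpa using (tendsto_pow_atTop_nhds_zero_of_norm_lt_one hlt).smul_const (e (μ + δ))
  | zero => simpa using tendsto_const_nhds
  | add x y _ _ hx hy => simpa [mul_add] using hx.add hy
  | smul c x _ hx =>
    have h : ∀ q : ℕ, (T ^ q) (θ ^ q • (e μ * c • x)) = c • (T ^ q) (θ ^ q • (e μ * x)) := by
      intro q
      rw [mul_smul_comm, smul_comm, map_smul]
    simp only [h]
    simpa using hx.const_smul c

theorem tendsto_choice_term (he0 : e 0 = 1) (hadd : ∀ a b, e (a + b) = e a * e b)
    {T : X →ₗ[ℂ] X} {Φ : ℂ → ℂ} (hT : ∀ a, T (e a) = Φ a • e a)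
    {J Y : Type*} [Fintype J] [DecidableEq J] [Fintype Y] {w : Y → ℝ} {g : Y → X}
    {η : ℝ} (hη : 0 ≤ η) (hg : ∀ y, g y ∈ Submodule.span ℂ (e '' Metric.closedBall 0 η))
    (a : J → ℂ) {b l : J → ℂ} (hb : ∀ j, ‖b j‖ ≤ 1) {σ : Y → Option J}
    (hσ : ∀ δ ∈ Metric.closedBall (0 : ℂ) (Fintype.card Y * η),
      ‖Φ (∑ j, choiceWeight w σ j • l j + δ)‖ < 1) :
    Tendsto (fun q : ℕ => (T ^ q) ((∏ y, (σ y).elim 1 a) • (∏ y, (σ y).elim 1 b) ^ q •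
        (e (∑ j, choiceWeight w σ j • l j) * ∏ y, (σ y).elim (g y) 1))) atTop (𝓝 0) := by
  have hθ : ‖∏ y, (σ y).elim 1 b‖ ≤ 1 := by
    rw [norm_prod]
    refine Finset.prod_le_one (fun y _ => norm_nonneg _) fun y _ => ?_
    cases σ y <;> simp [hb]
  have hG : ∏ y, (σ y).elim (g y) 1 ∈
      Submodule.span ℂ (e '' Metric.closedBall 0 (Fintype.card Y * η)) := by
    refine prod_mem_span_closedBall he0 hadd Finset.univ fun y _ => ?_
    cases σ y with
    | none => exact hg y
    | some j =>
      rw [Option.elim_some, Pi.one_apply, ← he0]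
      exact Submodule.subset_span ⟨0, by simpa using hη, rfl⟩
  have := (tendsto_pow_smul_mul_zero hadd hT hθ hσ hG).const_smul (∏ y, (σ y).elim 1 a)
  simpa only [map_smul, smul_zero] using this

theorem tendsto_prod_perturbed_zero (he0 : e 0 = 1) (hadd : ∀ a b, e (a + b) = e a * e b)
    {T : X →ₗ[ℂ] X} {Φ : ℂ → ℂ} (hT : ∀ a, T (e a) = Φ a • e a)
    {J Y : Type*} [Fintype J] [DecidableEq J] [Fintype Y] {w : Y → ℝ} {g : Y → X}
    {η : ℝ} (hη : 0 ≤ η) (hg : ∀ y, g y ∈ Submodule.span ℂ (e '' Metric.closedBall 0 η))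
    (a : J → ℂ) {b l : J → ℂ} (hb : ∀ j, ‖b j‖ ≤ 1)
    (hσ : ∀ σ : Y → Option J, ∀ δ ∈ Metric.closedBall (0 : ℂ) (Fintype.card Y * η),
      ‖Φ (∑ j, choiceWeight w σ j • l j + δ)‖ < 1) :
    Tendsto (fun q : ℕ => (T ^ q) (∏ y, (g y + ∑ j, (a j * b j ^ q) • e (w y * l j))))
      atTop (𝓝 0) := by
  classical
  simp only [prod_perturbed_eq_sum he0 hadd, map_sum]
  have := tendsto_finsetSum Finset.univ fun σ (_ : σ ∈ Finset.univ) =>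
    tendsto_choice_term he0 hadd hT hη hg a hb (hσ σ)
  rwa [Finset.sum_const_zero] at this

/-- Only the constant choices `σ = some j` survive. Such a term has frequency exactly `l j`, because
the weights sum to 1, and its factor `(b j ^ card Y * Φ (l j)) ^ q` is 1 for every `q`. -/
theorem tendsto_prod_perturbed (he0 : e 0 = 1) (hadd : ∀ a b, e (a + b) = e a * e b)
    {T : X →ₗ[ℂ] X} {Φ : ℂ → ℂ} (hT : ∀ a, T (e a) = Φ a • e a)
    {J Y : Type*} [Fintype J] [DecidableEq J] [Fintype Y] [Nonempty Y] {w : Y → ℝ}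
    (hw : ∑ y, w y = 1) {g : Y → X}
    {η : ℝ} (hη : 0 ≤ η) (hg : ∀ y, g y ∈ Submodule.span ℂ (e '' Metric.closedBall 0 η))
    {a b c l : J → ℂ} (hb : ∀ j, ‖b j‖ ≤ 1) (hac : ∀ j, a j ^ Fintype.card Y = c j)
    (hbΦ : ∀ j, b j ^ Fintype.card Y * Φ (l j) = 1)
    (hσ : ∀ σ : Y → Option J, (∀ j, σ ≠ fun _ => some j) →
      ∀ δ ∈ Metric.closedBall (0 : ℂ) (Fintype.card Y * η),
        ‖Φ (∑ j, choiceWeight w σ j • l j + δ)‖ < 1) :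
    Tendsto (fun q : ℕ => (T ^ q) (∏ y, (g y + ∑ j, (a j * b j ^ q) • e (w y * l j))))
      atTop (𝓝 (∑ j, c j • e (l j))) := by
  classical
  simp only [prod_perturbed_eq_sum he0 hadd, map_sum]
  have hlim : ∑ j, c j • e (l j) = ∑ σ : Y → Option J, ∑ j,
      if σ = fun _ => some j then c j • e (l j) else 0 := by
    rw [Finset.sum_comm]
    simp
  rw [hlim]
  refine tendsto_finsetSum Finset.univ fun σ _ => ?_
  by_cases hconst : ∃ j, σ = fun _ => some j
  · obtain ⟨j, rfl⟩ := hconst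
    have h1 : ∀ i, ((fun _ : Y => some j) = fun _ => some i) ↔ i = j := by
      intro i
      simp [funext_iff, eq_comm]
    have h2 : ∑ i, choiceWeight w (fun _ : Y => some j) i • l i = l j := by
      rw [Finset.sum_eq_single j]
      · simp [choiceWeight, hw]
      · intro i _ hij
        simp [choiceWeight, hij.symm]
      · simp
    simp only [h1, Finset.sum_ite_eq', Finset.mem_univ, if_true, h2, Option.elim_some,
      Pi.one_apply, Finset.prod_const, Finset.card_univ, hac, mul_one, map_smul, one_pow]
    refine tendsto_const_nhds.congr fun q => ?_
    rw [pow_apply_of_eigenvector hT, smul_smul (_ ^ q), ← mul_pow, hbΦ, one_pow, one_smul]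
  · push Not at hconst
    rw [Finset.sum_eq_zero fun j _ => if_neg (hconst j)]
    exact tendsto_choice_term he0 hadd hT hη hg a hb (hσ σ hconst)

end Eigenvectors

/-! ### Genericity -/

/-- The variables of a monomial, counted with multiplicity. -/
abbrev MonomialIndex {ι : Type*} (α : ι →₀ ℕ) : Type _ := Σ i : α.support, Fin (α i)

theorem prod_monomialIndex {ι R : Type*} [CommMonoid R] (α : ι →₀ ℕ) (f : ι → R) :
    ∏ y : MonomialIndex α, f y.1 = α.prod fun i n => f i ^ n := by
  rw [Fintype.prod_sigma, Finsupp.prod, ← Finset.prod_coe_sort α.support fun i => f i ^ α i]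
  simp

theorem sum_monomialIndex {ι : Type*} (α : ι →₀ ℕ) (w : ι → ℝ) :
    ∑ y : MonomialIndex α, w y.1 = α.sum fun i n => n * w i := by
  rw [Fintype.sum_sigma, Finsupp.sum, ← Finset.sum_coe_sort α.support fun i => α i * w i]
  simp

theorem nonempty_monomialIndex {ι : Type*} {α : ι →₀ ℕ} (hα : α ≠ 0) :
    Nonempty (MonomialIndex α) := by
  obtain ⟨i, hi⟩ := Finsupp.support_nonempty_iff.2 hα
  exact ⟨⟨⟨i, hi⟩, ⟨0, Nat.pos_of_ne_zero (Finsupp.mem_support_iff.1 hi)⟩⟩⟩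

section Genericity

variable {X : Type*} [CommRing X] [Algebra ℂ X] {e : ℂ → X}
variable [TopologicalSpace X] [IsTopologicalRing X] [ContinuousSMul ℂ X]

/-- The density step of the Baire argument. It matters that `β` depends on `A` alone and is fixed
before the target `h` and the open sets. -/
theorem exists_pow_monomials_mem (he : Continuous e) (he0 : e 0 = 1)
    (hadd : ∀ a b, e (a + b) = e a * e b) {T : X →ₗ[ℂ] X} {Φ : ℂ → ℂ} (hΦ : Continuous Φ)
    (hT : ∀ a, T (e a) = Φ a • e a) {Γ : Set ℂ}
    (hΓ : Dense (Submodule.span ℂ (e '' Γ) : Set X))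
    (hzero : ∀ η : ℝ, 0 < η →
      Dense (Submodule.span ℂ (e '' Metric.closedBall 0 η) : Set X))
    (hfreq : ∀ x ∈ Γ, ∃ᶠ z in 𝓝 x, 1 < ‖Φ z‖)
    (hcomb : ∀ (s : Finset ℂ), (s : Set ℂ) ⊆ Γ → ∀ t : s → ℝ, (∀ j, 0 ≤ t j) → ∑ j, t j ≤ 1 →
      (∀ j, t ≠ Pi.single j 1) → ‖Φ (∑ j, t j • (j : ℂ))‖ < 1)
    {ι : Type*} [Countable ι] [DecidableEq ι] {A : Finset (ι →₀ ℕ)} (hA : A.Nonempty) (h0 : 0 ∉ A) :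
    ∃ β : A, ∀ (h : X), ∀ B ∈ 𝓝 (Pi.single β h : A → X), ∀ U : Set (ι → X), IsOpen U →
      U.Nonempty → ∃ f ∈ U, ∃ q : ℕ,
        (fun α : A => (T ^ q) (α.1.prod fun i n => f i ^ n)) ∈ B := by
  classical
  obtain ⟨β, hβ, w, hw, hwβ, hwα⟩ := exists_weight_unique_maximizer hA h0
  refine ⟨⟨β, hβ⟩, fun h B hB U hU hUne => ?_⟩
  have hY : ∀ α : A, Nonempty (MonomialIndex α.1) := fun α =>
    nonempty_monomialIndex fun h => h0 (h ▸ α.2)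
  have hw' : ∀ α : A, ∀ y : MonomialIndex α.1, 0 < w y.1 := fun _ y => hw _
  -- the target is approximated by a combination of eigenvectors
  obtain ⟨h', hh', hB'⟩ : ∃ h' ∈ (Submodule.span ℂ (e '' Γ) : Set X),
      (Pi.single ⟨β, hβ⟩ h' : A → X) ∈ interior B := by
    have hcont : Continuous fun x : X => (Pi.single ⟨β, hβ⟩ x : A → X) := continuous_single (A := fun _ : A => X) _
    obtain ⟨x, hx1, hx2⟩ := hΓ.inter_open_nonempty _ (isOpen_interior.preimage hcont)
      ⟨h, mem_interior_iff_mem_nhds.2 hB⟩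
    exact ⟨x, hx2, hx1⟩
  obtain ⟨s, hs, c, rfl⟩ := (Submodule.mem_span_image_iff_exists_fun ℂ).1 hh'
  -- perturbation of the eigenvalues
  have hev1 : ∀ᶠ p : (s → ℂ) × ℂ in 𝓝 (fun j => (j : ℂ), 0),
      (Pi.single ⟨β, hβ⟩ (∑ j, c j • e (p.1 j)) : A → X) ∈ interior B := by
    have hcont : Continuous fun p : (s → ℂ) × ℂ =>
        (Pi.single ⟨β, hβ⟩ (∑ j, c j • e (p.1 j)) : A → X) :=
      (continuous_single (A := fun _ : A => X) _).comp (continuous_finsetSum _ fun j _ =>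
        (he.comp ((continuous_apply j).comp continuous_fst)).const_smul (c j))
    exact hcont.continuousAt.eventually (isOpen_interior.mem_nhds hB')
  -- At the unperturbed points this is `hcomb`; being finitely many strict inequalities, it persists
  -- for nearby frequencies `p.1` and a small shift `p.2`, which will absorb the frequencies of `g`.
  have hev2 : ∀ᶠ p : (s → ℂ) × ℂ in 𝓝 (fun j => (j : ℂ), 0),
      ∀ (α : A) (σ : MonomialIndex α.1 → Option s),
        (α.1 = β → ∀ j, σ ≠ fun _ => some j) →
          ‖Φ (∑ j, choiceWeight (fun y => w y.1) σ j • p.1 j + p.2)‖ < 1 := by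
    refine eventually_all.2 fun α => eventually_all.2 fun σ => ?_
    by_cases hσ : α.1 = β → ∀ j, σ ≠ fun _ => some j
    · have hcont : Continuous fun p : (s → ℂ) × ℂ =>
          ‖Φ (∑ j, choiceWeight (fun y => w y.1) σ j • p.1 j + p.2)‖ := by fun_prop
      have hle : ∑ y : MonomialIndex α.1, w y.1 ≤ 1 := by
        rw [sum_monomialIndex]
        by_cases hαβ : α.1 = β
        · rw [hαβ, hwβ]
        · exact (hwα _ α.2 hαβ).le
      have hlt : ‖Φ (∑ j, choiceWeight (fun y => w y.1) σ j • (j : ℂ) + 0)‖ < 1 := by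
        rw [add_zero]
        refine hcomb s hs _ (choiceWeight_nonneg (hw' α) σ)
          ((sum_choiceWeight_le (hw' α) σ).trans hle) fun j hj => ?_
        -- A unit vector of weights requires total weight 1, hence `α = β`, and then a constant
        -- choice.
        have h1 : choiceWeight (fun y => w y.1) σ j = 1 := by rw [hj, Pi.single_eq_same]
        have hαβ : α.1 = β := by
          by_contra hαβ
          have h2 := hwα _ α.2 hαβ
          have h3 := (Finset.single_le_sum (fun i _ => choiceWeight_nonneg (hw' α) σ i)
            (Finset.mem_univ j)).trans (sum_choiceWeight_le (hw' α) σ)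
          rw [sum_monomialIndex] at h3
          linarith
        exact hσ hαβ j (eq_const_of_choiceWeight_eq (hw' α) (hle.trans h1.ge))
      filter_upwards [hcont.continuousAt.eventually (gt_mem_nhds hlt)] with p hp _
      exact hp
    · exact Eventually.of_forall fun p hp => absurd hp hσ
  obtain ⟨ε, hε, hball⟩ := Metric.eventually_nhds_iff.1 (hev1.and hev2)
  have hl : ∀ j : s, ∃ z : ℂ, 1 < ‖Φ z‖ ∧ dist z j < ε := fun j =>
    ((hfreq j (hs j.2)).and_eventually (Metric.ball_mem_nhds (j : ℂ) hε)).exists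
  choose l hl1 hl2 using hl
  have hdist : ∀ δ : ℂ, ‖δ‖ < ε → dist (l, δ) (fun j : s => (j : ℂ), (0 : ℂ)) < ε := by
    intro δ hδ
    rw [Prod.dist_eq, max_lt_iff]
    exact ⟨(dist_pi_lt_iff hε).2 hl2, by simpa using hδ⟩
  have hlB := (hball (hdist 0 (by simpa using hε))).1
  set N : ℕ := ∑ α : A, Fintype.card (MonomialIndex α.1) with hN
  -- A product of at most `N` factors with frequencies of size at most `η` has frequencies of size
  -- below `ε`.
  set η : ℝ := ε / (N + 1) with hη
  have hη0 : 0 < η := by positivity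
  have hcard : ∀ (α : A), ∀ δ ∈ Metric.closedBall (0 : ℂ)
      (Fintype.card (MonomialIndex α.1) * η), ‖δ‖ < ε := by
    intro α δ hδ
    have h1 : Fintype.card (MonomialIndex α.1) ≤ N :=
      Finset.single_le_sum (f := fun α : A => Fintype.card (MonomialIndex α.1))
        (fun _ _ => Nat.zero_le _) (Finset.mem_univ α)
    have h1' : (Fintype.card (MonomialIndex α.1) : ℝ) ≤ N := by exact_mod_cast h1
    have h2 : (N + 1) * η = ε := by
      rw [hη]
      field_simp
    have h3 : ‖δ‖ ≤ Fintype.card (MonomialIndex α.1) * η := by simpa using hδ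
    nlinarith
  -- roots of the coefficients
  set n := Fintype.card (MonomialIndex β) with hn
  have hnpos : 0 < n := by
    have := hY ⟨β, hβ⟩
    exact Fintype.card_pos
  choose a ha using fun j : s => IsAlgClosed.exists_pow_nat_eq (c j) hnpos
  -- The `n` factors of the monomial `β` contribute `b j ^ n`, which must invert the eigenvalue. As
  -- this eigenvalue exceeds 1 in modulus, `‖b j‖ < 1`, so the perturbation vanishes as `q → ∞` and
  -- `f q` ends up in `U`.
  choose b hb using fun j : s => IsAlgClosed.exists_pow_nat_eq (Φ (l j))⁻¹ hnpos
  have hb1 : ∀ j, ‖b j‖ < 1 := by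
    intro j
    have h1 : ‖b j‖ ^ n < 1 := by
      rw [← norm_pow, hb, norm_inv]
      exact inv_lt_one_of_one_lt₀ (hl1 j)
    exact (pow_lt_one_iff_of_nonneg (norm_nonneg _) hnpos.ne').1 h1
  have hbΦ : ∀ j, b j ^ n * Φ (l j) = 1 := by
    intro j
    rw [hb]
    refine inv_mul_cancel₀ fun h => ?_
    have := hl1 j
    rw [h, norm_zero] at this
    linarith
  -- the perturbed family
  obtain ⟨g, hgU, hg⟩ : ∃ g ∈ U, ∀ i, g i ∈ Submodule.span ℂ (e '' Metric.closedBall 0 η) := by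
    have hd : Dense (Set.pi Set.univ fun _ : ι =>
        (Submodule.span ℂ (e '' Metric.closedBall 0 η) : Set X)) :=
      dense_pi _ fun _ _ => hzero η hη0
    obtain ⟨g, hgU, hg⟩ := hd.inter_open_nonempty U hU hUne
    exact ⟨g, hgU, fun i => hg i (Set.mem_univ i)⟩
  set f : ℕ → ι → X := fun q i => g i + ∑ j, (a j * b j ^ q) • e (w i * l j) with hf
  have hfg : Tendsto f atTop (𝓝 g) := by
    refine tendsto_pi_nhds.2 fun i => ?_
    have h1 : ∀ j ∈ Finset.univ, Tendsto (fun q : ℕ => (a j * b j ^ q) • e (w i * l j))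
        atTop (𝓝 0) := by
      intro j _
      simpa using ((tendsto_pow_atTop_nhds_zero_of_norm_lt_one (hb1 j)).const_mul
        (a j)).smul_const (e (w i * l j))
    have h2 := (tendsto_finsetSum _ h1).const_add (g i)
    rwa [Finset.sum_const_zero, add_zero] at h2
  have hsmall : ∀ (α : A) (σ : MonomialIndex α.1 → Option s),
      (α.1 = β → ∀ j, σ ≠ fun _ => some j) → ∀ δ ∈ Metric.closedBall (0 : ℂ)
        (Fintype.card (MonomialIndex α.1) * η),
          ‖Φ (∑ j, choiceWeight (fun y => w y.1) σ j • l j + δ)‖ < 1 :=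
    fun α σ hσ δ hδ => (hball (hdist δ (hcard α δ hδ))).2 α σ hσ
  have hprod : ∀ (α : ι →₀ ℕ) (q : ℕ), (α.prod fun i n => f q i ^ n) = ∏ y : MonomialIndex α,
      (g y.1 + ∑ j, (a j * b j ^ q) • e (w y.1 * l j)) := fun α q =>
    (prod_monomialIndex α (f q)).symm
  have hlim : Tendsto (fun q => (T ^ q) (β.prod fun i n => f q i ^ n)) atTop
      (𝓝 (∑ j, c j • e (l j))) := by
    simp only [hprod]
    have := hY ⟨β, hβ⟩
    have hw1 : ∑ y : MonomialIndex β, w y.1 = 1 := by rw [sum_monomialIndex, hwβ]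
    exact tendsto_prod_perturbed (w := fun y : MonomialIndex β => w y.1)
      (g := fun y : MonomialIndex β => g y.1) he0 hadd hT hw1 hη0.le (fun y => hg _)
      (fun j => (hb1 j).le) ha hbΦ fun σ hσ => hsmall ⟨β, hβ⟩ σ fun _ => hσ
  have hTf : Tendsto (fun q => fun α : A => (T ^ q) (α.1.prod fun i n => f q i ^ n)) atTop
      (𝓝 (Pi.single ⟨β, hβ⟩ (∑ j, c j • e (l j)))) := by
    refine tendsto_pi_nhds.2 fun α => ?_
    by_cases hα : α = ⟨β, hβ⟩
    · rw [hα, Pi.single_eq_same]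
      exact hlim
    · rw [Pi.single_eq_of_ne hα]
      simp only [hprod]
      exact tendsto_prod_perturbed_zero (w := fun y : MonomialIndex α.1 => w y.1)
        (g := fun y : MonomialIndex α.1 => g y.1) he0 hadd hT hη0.le
        (fun y => hg _) a (fun j => (hb1 j).le) fun σ =>
          hsmall α σ fun h => absurd (Subtype.ext h) hα
  obtain ⟨q, hq1, hq2⟩ := ((hfg.eventually (hU.mem_nhds hgU)).and
    (hTf.eventually (mem_interior_iff_mem_nhds.1 hlB))).exists
  exact ⟨f q, hq1, q, hq2⟩

/-- Generically, all non-zero polynomial expressions without constant term are hypercyclic. -/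
theorem eventually_residual_aeval_hypercyclic [SecondCountableTopology X] (he : Continuous e)
    (he0 : e 0 = 1) (hadd : ∀ a b, e (a + b) = e a * e b) {T : X →ₗ[ℂ] X} (hTc : Continuous T)
    {Φ : ℂ → ℂ} (hΦ : Continuous Φ) (hT : ∀ a, T (e a) = Φ a • e a) {Γ : Set ℂ}
    (hΓ : Dense (Submodule.span ℂ (e '' Γ) : Set X))
    (hzero : ∀ η : ℝ, 0 < η →
      Dense (Submodule.span ℂ (e '' Metric.closedBall 0 η) : Set X))
    (hfreq : ∀ x ∈ Γ, ∃ᶠ z in 𝓝 x, 1 < ‖Φ z‖)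
    (hcomb : ∀ (s : Finset ℂ), (s : Set ℂ) ⊆ Γ → ∀ t : s → ℝ, (∀ j, 0 ≤ t j) → ∑ j, t j ≤ 1 →
      (∀ j, t ≠ Pi.single j 1) → ‖Φ (∑ j, t j • (j : ℂ))‖ < 1)
    {ι : Type*} [Countable ι] :
    ∀ᶠ f : ι → X in residual (ι → X), ∀ P : MvPolynomial ι ℂ, P ≠ 0 →
      MvPolynomial.constantCoeff P = 0 → MvPolynomial.aeval f P ∈ hypercyclicVectors T := by
  classical
  let I := {A : Finset (ι →₀ ℕ) // A.Nonempty ∧ 0 ∉ A}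
  choose β hβ using fun A : I =>
    exists_pow_monomials_mem he he0 hadd hΦ hT hΓ hzero hfreq hcomb A.2.1 A.2.2
  have hTpow : ∀ q : ℕ, Continuous (T ^ q) := fun q => by
    rw [Module.End.coe_pow]
    exact hTc.iterate q
  -- Only basic sets `B` meeting the `β A` coordinate axis are used: for these `O A B` is open and
  -- dense, and there are countably many pairs `(A, B)`.
  let O : ∀ A : I, Set (A.1 → X) → Set (ι → X) := fun A B =>
    {f | ∃ q : ℕ, (fun α : A.1 => (T ^ q) (α.1.prod fun i n => f i ^ n)) ∈ B}
  have hO : ∀ A : I, ∀ B ∈ {B ∈ TopologicalSpace.countableBasis (A.1 → X) |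
      ∃ h : X, (Pi.single (β A) h : A.1 → X) ∈ B}, O A B ∈ residual (ι → X) := by
    rintro A B ⟨hB, h, hh⟩
    have hBo := TopologicalSpace.isOpen_of_mem_countableBasis hB
    refine residual_of_dense_open ?_ ?_
    · have : O A B = ⋃ q : ℕ,
          (fun f : ι → X => fun α : A.1 => (T ^ q) (α.1.prod fun i n => f i ^ n)) ⁻¹' B := by
        ext f
        simp [O]
      rw [this]
      refine isOpen_iUnion fun q => hBo.preimage (continuous_pi fun α => (hTpow q).comp ?_)
      exact continuous_finsetProd _ fun i _ => (continuous_apply i).pow _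
    · refine dense_iff_inter_open.2 fun U hU hUne => ?_
      obtain ⟨f, hfU, hf⟩ := hβ A h B (hBo.mem_nhds hh) U hU hUne
      exact ⟨f, hfU, hf⟩
  have hall : ∀ᶠ f : ι → X in residual (ι → X), ∀ A : I,
      ∀ B ∈ {B ∈ TopologicalSpace.countableBasis (A.1 → X) |
        ∃ h : X, (Pi.single (β A) h : A.1 → X) ∈ B}, f ∈ O A B := by
    refine eventually_countable_forall.2 fun A => ?_
    have hc : {B ∈ TopologicalSpace.countableBasis (A.1 → X) |
        ∃ h : X, (Pi.single (β A) h : A.1 → X) ∈ B}.Countable :=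
      (TopologicalSpace.countable_countableBasis _).mono (Set.sep_subset _ _)
    exact (eventually_countable_ball hc).2 (hO A)
  filter_upwards [hall] with f hf P hP hP0
  have h0 : (0 : ι →₀ ℕ) ∉ P.support := by
    rw [MvPolynomial.mem_support_iff, not_not]
    exact hP0
  let A : I := ⟨P.support, MvPolynomial.support_nonempty.2 hP, h0⟩
  refine dense_iff_inter_open.2 fun V hV ⟨v, hv⟩ => ?_
  have hS : Continuous fun x : A.1 → X => ∑ α : A.1, P.coeff α.1 • x α := by fun_prop
  have hcβ : P.coeff (β A).1 ≠ 0 := MvPolynomial.mem_support_iff.1 (β A).2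
  -- The target on the `β A` axis is scaled so that the linear combination given by the coefficients
  -- of `P` sends it to `v`.
  have hmem : (Pi.single (β A) ((P.coeff (β A).1)⁻¹ • v) : A.1 → X) ∈
      (fun x : A.1 → X => ∑ α : A.1, P.coeff α.1 • x α) ⁻¹' V := by
    rw [Set.mem_preimage, Finset.sum_eq_single (β A)]
    · rwa [Pi.single_eq_same, smul_smul, mul_inv_cancel₀ hcβ, one_smul]
    · intro α _ hα
      rw [Pi.single_eq_of_ne hα, smul_zero]
    · simp
  obtain ⟨B, hB, hB1, hB2⟩ :=
    (TopologicalSpace.isBasis_countableBasis (A.1 → X)).exists_subset_of_mem_open hmem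
      (hV.preimage hS)
  obtain ⟨q, hq⟩ := hf A B ⟨hB, _, hB1⟩
  refine ⟨_, ?_, ⟨q, rfl⟩⟩
  have := hB2 hq
  rw [Set.mem_preimage] at this
  convert! this using 1
  have hsupp : MvPolynomial.aeval f P = ∑ α : A.1, P.coeff α.1 • α.1.prod fun i n => f i ^ n := by
    rw [MvPolynomial.aeval_def, MvPolynomial.eval₂_eq, ← Finset.sum_coe_sort]
    exact Finset.sum_congr rfl fun α _ => (Algebra.smul_def _ _).symm
  change T^[q] (MvPolynomial.aeval f P) = _
  rw [← Module.End.coe_pow, hsupp, map_sum]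
  simp only [map_smul]

end Genericity

/-! ### Free generation -/

section FreeGeneration

variable {ι X : Type} [CommRing X] [Algebra ℂ X] {f : ι → X}

theorem exists_aeval_eq_of_mem_generatedAlgebra {x : X} (hx : x ∈ generatedAlgebra f) :
    ∃ P : MvPolynomial ι ℂ, MvPolynomial.constantCoeff P = 0 ∧ MvPolynomial.aeval f P = x := by
  induction hx using NonUnitalAlgebra.adjoin_induction with
  | mem x hx =>
    obtain ⟨i, rfl⟩ := hx
    exact ⟨MvPolynomial.X i, by simp, by simp⟩
  | add x y _ _ hx hy =>
    obtain ⟨P, hP, rfl⟩ := hx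
    obtain ⟨Q, hQ, rfl⟩ := hy
    exact ⟨P + Q, by simp [hP, hQ], by simp⟩
  | zero => exact ⟨0, by simp, by simp⟩
  | mul x y _ _ hx hy =>
    obtain ⟨P, hP, rfl⟩ := hx
    obtain ⟨Q, hQ, rfl⟩ := hy
    exact ⟨P * Q, by simp [hP], by simp⟩
  | smul c x _ hx =>
    obtain ⟨P, hP, rfl⟩ := hx
    exact ⟨c • P, by simp [MvPolynomial.smul_eq_C_mul, hP], by simp⟩

/-- Each element of the algebra is the value of a unique polynomial without constant term, which can
be evaluated in any other commutative algebra. -/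
theorem freelyGenerates_of_aeval_ne_zero
    (hf : ∀ P : MvPolynomial ι ℂ, P ≠ 0 → MvPolynomial.constantCoeff P = 0 →
      MvPolynomial.aeval f P ≠ 0) : FreelyGenerates f := by
  intro A' _ _ _ _ g
  have hinj : ∀ P Q : MvPolynomial ι ℂ, MvPolynomial.constantCoeff P = 0 →
      MvPolynomial.constantCoeff Q = 0 → MvPolynomial.aeval f P = MvPolynomial.aeval f Q →
        P = Q := by
    intro P Q hP hQ h
    by_contra hne
    exact hf (P - Q) (sub_ne_zero.2 hne) (by rw [map_sub, hP, hQ, sub_zero])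
      (by rw [map_sub, h, sub_self])
  choose p hp0 hp using fun x : generatedAlgebra f => exists_aeval_eq_of_mem_generatedAlgebra x.2
  -- `A'` may lack a unit, so evaluation takes place in its unitization. The scalar part of the
  -- result is the constant coefficient, so polynomials without constant term land in `A'`.
  let ψ : MvPolynomial ι ℂ →ₐ[ℂ] Unitization ℂ A' :=
    MvPolynomial.aeval fun i => (Unitization.inr (g i) : Unitization ℂ A')
  have hψ : ∀ P, (ψ P).fst = MvPolynomial.constantCoeff P := by
    intro P
    have : (Unitization.fstHom ℂ A').comp ψ =
        (MvPolynomial.aeval fun _ => (0 : ℂ) : MvPolynomial ι ℂ →ₐ[ℂ] ℂ) := by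
      ext i
      simp [ψ]
    have h := DFunLike.congr_fun this P
    rw [MvPolynomial.aeval_zero'] at h
    exact h
  have hpX : ∀ i, p ⟨f i, NonUnitalAlgebra.subset_adjoin ℂ (Set.mem_range_self i)⟩ =
      MvPolynomial.X i := fun i =>
    hinj _ _ (hp0 _) (by simp) (by rw [hp, MvPolynomial.aeval_X])
  have hpadd : ∀ x y, p (x + y) = p x + p y := fun x y =>
    hinj _ _ (hp0 _) (by simp [hp0]) (by rw [map_add, hp, hp, hp]; rfl)
  have hpmul : ∀ x y, p (x * y) = p x * p y := fun x y =>
    hinj _ _ (hp0 _) (by simp [hp0]) (by rw [map_mul, hp, hp, hp]; rfl)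
  have hpzero : p 0 = 0 := hinj _ _ (hp0 _) (by simp) (by rw [map_zero, hp]; rfl)
  have hpsmul : ∀ (c : ℂ) x, p (c • x) = c • p x := fun c x =>
    hinj _ _ (hp0 _) (by simp [MvPolynomial.smul_eq_C_mul, hp0])
      (by rw [map_smul, hp, hp]; rfl)
  let φ : generatedAlgebra f →ₙₐ[ℂ] A' :=
    { toFun := fun x => (ψ (p x)).snd
      map_smul' := fun c x => by simp [hpsmul]
      map_zero' := by simp [hpzero]
      map_add' := fun x y => by simp [hpadd]
      map_mul' := fun x y => by simp [hpmul, Unitization.snd_mul, hψ, hp0] }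
  have hφ : ∀ i, φ ⟨f i, NonUnitalAlgebra.subset_adjoin ℂ (Set.mem_range_self i)⟩ = g i := by
    intro i
    change (ψ (p _)).snd = g i
    rw [hpX]
    simp [ψ]
  refine ⟨φ, hφ, fun φ' hφ' => ?_⟩
  ext ⟨x, hx⟩
  refine NonUnitalAlgebra.adjoin_induction
    (p := fun x hx => φ' ⟨x, hx⟩ = φ ⟨x, hx⟩) ?_ ?_ ?_ ?_ ?_ hx
  · rintro _ ⟨i, rfl⟩
    exact (hφ' i).trans (hφ i).symm
  · intro x y hx hy h1 h2
    change φ' ((⟨x, hx⟩ : generatedAlgebra f) + ⟨y, hy⟩) =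
      φ ((⟨x, hx⟩ : generatedAlgebra f) + ⟨y, hy⟩)
    rw [map_add, map_add, h1, h2]
  · exact (map_zero φ').trans (map_zero φ).symm
  · intro x y hx hy h1 h2
    change φ' ((⟨x, hx⟩ : generatedAlgebra f) * ⟨y, hy⟩) =
      φ ((⟨x, hx⟩ : generatedAlgebra f) * ⟨y, hy⟩)
    rw [map_mul, map_mul, h1, h2]
  · intro c x hx h1
    change φ' (c • (⟨x, hx⟩ : generatedAlgebra f)) = φ (c • (⟨x, hx⟩ : generatedAlgebra f))
    rw [map_smul, map_smul, h1]

/-- Multiplying a relation by a variable removes its constant term. -/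
theorem aeval_injective_of_aeval_ne_zero [Nonempty ι]
    (hf : ∀ P : MvPolynomial ι ℂ, P ≠ 0 → MvPolynomial.constantCoeff P = 0 →
      MvPolynomial.aeval f P ≠ 0) :
    Function.Injective (MvPolynomial.aeval f : MvPolynomial ι ℂ →ₐ[ℂ] X) := by
  refine (injective_iff_map_eq_zero _).2 fun P hP => ?_
  by_contra hne
  obtain ⟨i⟩ := ‹Nonempty ι›
  exact hf (MvPolynomial.X i * P) (mul_ne_zero (MvPolynomial.X_ne_zero i) hne) (by simp)
    (by rw [map_mul, hP, mul_zero])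

/-- Finitely many generators involve only finitely many variables; any other `f i` would be a
polynomial in the remaining `f j`, against algebraic independence. -/
theorem not_isFinitelyGeneratedAlgebra_generatedAlgebra [Infinite ι]
    (hf : Function.Injective (MvPolynomial.aeval f : MvPolynomial ι ℂ →ₐ[ℂ] X)) :
    ¬ IsFinitelyGeneratedAlgebra (generatedAlgebra f) := by
  classical
  rintro ⟨s, hs⟩
  choose p hp0 hp using fun x : s => exists_aeval_eq_of_mem_generatedAlgebra
    (hs ▸ NonUnitalAlgebra.subset_adjoin ℂ x.2 : (x : X) ∈ generatedAlgebra f)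
  obtain ⟨i, hi⟩ := Infinite.exists_notMem_finset (Finset.univ.biUnion fun x : s => (p x).vars)
  let C : Subalgebra ℂ X := (MvPolynomial.supported ℂ ({i}ᶜ : Set ι)).map (MvPolynomial.aeval f)
  have hsC : NonUnitalAlgebra.adjoin ℂ (s : Set X) ≤ C.toNonUnitalSubalgebra := by
    refine NonUnitalAlgebra.adjoin_le fun x hx => ?_
    refine ⟨p ⟨x, hx⟩, MvPolynomial.mem_supported.2 fun j hj hji => hi ?_, hp ⟨x, hx⟩⟩
    rw [← (hji : j = i)]
    exact Finset.mem_biUnion.2 ⟨⟨x, hx⟩, Finset.mem_univ _, hj⟩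
  obtain ⟨Q, hQ, hQi⟩ := hsC (hs ▸ NonUnitalAlgebra.subset_adjoin ℂ (Set.mem_range_self i) :
    f i ∈ NonUnitalAlgebra.adjoin ℂ (s : Set X))
  have hQX : Q = MvPolynomial.X i := hf (by simpa using hQi)
  rw [hQX] at hQ
  exact MvPolynomial.X_mem_supported.1 hQ rfl

theorem IsFreeGenerators.comp_equiv {ι κ A : Type} [NonUnitalCommRing A] [Module ℂ A] {y : ι → A}
    (hy : IsFreeGenerators y) (σ : κ ≃ ι) : IsFreeGenerators (y ∘ σ) := by
  intro A' _ _ _ _ g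
  obtain ⟨φ, hφ, huniq⟩ := hy A' (g ∘ σ.symm)
  refine ⟨φ, fun k => by simp [hφ], fun ψ hψ => huniq ψ fun i => ?_⟩
  simpa using hψ (σ.symm i)

theorem FreelyGenerates.isFreeAlgebraOfCardinal (hf : FreelyGenerates f)
    (hinj : Function.Injective f) : IsFreeAlgebraOfCardinal #ι (generatedAlgebra f) := by
  set y : ι → generatedAlgebra f := fun i =>
    ⟨f i, NonUnitalAlgebra.subset_adjoin ℂ (Set.mem_range_self i)⟩ with hy
  have hyinj : Function.Injective y := fun i j h => hinj (congrArg Subtype.val h)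
  refine ⟨Set.range y, Cardinal.mk_range_eq y hyinj, ?_⟩
  have := IsFreeGenerators.comp_equiv hf (Equiv.ofInjective y hyinj).symm
  convert! this using 2 with z
  exact (Equiv.apply_ofInjective_symm hyinj z).symm

variable [TopologicalSpace X]

theorem ne_zero_of_mem_hypercyclicVectors [T1Space X] [Nontrivial X] {T : X →ₗ[ℂ] X} {x : X}
    (hx : x ∈ hypercyclicVectors T) : x ≠ 0 := by
  rintro rfl
  have h0 : Set.range (fun n : ℕ => T^[n] (0 : X)) ⊆ {0} := by
    rintro _ ⟨n, rfl⟩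
    exact Function.iterate_fixed (map_zero T) n
  obtain ⟨y, hy⟩ := exists_ne (0 : X)
  have := (Dense.mono h0 hx).closure_eq
  rw [closure_singleton] at this
  exact hy (this ▸ Set.mem_univ y : y ∈ ({0} : Set X))

theorem isHypercyclicAlgebra_generatedAlgebra {T : X → X}
    (hf : ∀ P : MvPolynomial ι ℂ, P ≠ 0 → MvPolynomial.constantCoeff P = 0 →
      MvPolynomial.aeval f P ∈ hypercyclicVectors T) :
    IsHypercyclicAlgebra T (generatedAlgebra f) := by
  intro x hx hx0
  obtain ⟨P, hP, rfl⟩ := exists_aeval_eq_of_mem_generatedAlgebra hx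
  exact hf P (fun h => hx0 (by rw [h, map_zero])) hP

end FreeGeneration

/-! ### From generic families to dense algebrability -/

theorem eventually_residual_dense_range (X : Type*) [TopologicalSpace X]
    [SecondCountableTopology X] : ∀ᶠ f : ℕ → X in residual (ℕ → X), Dense (Set.range f) := by
  have hall : ∀ᶠ f : ℕ → X in residual (ℕ → X), ∀ B ∈ TopologicalSpace.countableBasis X,
      ∃ n, f n ∈ B := by
    refine (eventually_countable_ball (TopologicalSpace.countable_countableBasis X)).2
      fun B hB => residual_of_dense_open ?_ ?_
    · simp only [Set.ofPred_exists]
      exact isOpen_iUnion fun n =>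
        (TopologicalSpace.isOpen_of_mem_countableBasis hB).preimage (continuous_apply n)
    · refine dense_iff_inter_open.2 fun U hU ⟨f, hf⟩ => ?_
      obtain ⟨b, hb⟩ := TopologicalSpace.nonempty_of_mem_countableBasis hB
      -- The product topology sees finitely many coordinates at a time, so changing a far coordinate
      -- to `b` is a small perturbation.
      have hlim : Tendsto (fun k => Function.update f k b) atTop (𝓝 f) := by
        refine tendsto_pi_nhds.2 fun i => tendsto_const_nhds.congr' ?_
        filter_upwards [eventually_gt_atTop i] with k hk
        rw [Function.update_of_ne hk.ne]
      obtain ⟨k, hk⟩ := (hlim.eventually (hU.mem_nhds hf)).exists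
      exact ⟨_, hk, k, by simpa using hb⟩
  filter_upwards [hall] with f hf
  refine (TopologicalSpace.isBasis_countableBasis X).dense_iff.2 fun B hB _ => ?_
  obtain ⟨n, hn⟩ := hf B hB
  exact ⟨f n, hn, n, rfl⟩

/-- Algebrability of the hypercyclic vectors of an operator for which generic families generate
hypercyclic algebras. -/
theorem algebrable_of_eventually_residual {X : Type} [CommRing X] [Algebra ℂ X]
    [TopologicalSpace X] [T1Space X] [Nontrivial X] [SecondCountableTopology X]
    [BaireSpace (ℕ → X)] (T : X →ₗ[ℂ] X)
    (hgen : ∀ (ι : Type) [Countable ι], ∀ᶠ f : ι → X in residual (ι → X),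
      ∀ P : MvPolynomial ι ℂ, P ≠ 0 → MvPolynomial.constantCoeff P = 0 →
        MvPolynomial.aeval f P ∈ hypercyclicVectors T) :
    IsDenseAlgebrable (hypercyclicVectors T) ∧
    (∀ N : ℕ, 1 ≤ N → {f : Fin N → X | FreelyGenerates f ∧
      IsHypercyclicAlgebra T (generatedAlgebra f)} ∈ residual (Fin N → X)) ∧
    {f : ℕ → X | FreelyGenerates f ∧ Dense (generatedAlgebra f : Set X) ∧
      IsHypercyclicAlgebra T (generatedAlgebra f)} ∈ residual (ℕ → X) ∧
    IsDenselyStronglyAlgebrable (hypercyclicVectors T) := by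
  have hne : ∀ {ι : Type} {f : ι → X}, (∀ P : MvPolynomial ι ℂ, P ≠ 0 →
      MvPolynomial.constantCoeff P = 0 →
        MvPolynomial.aeval f P ∈ hypercyclicVectors T) →
      ∀ P : MvPolynomial ι ℂ, P ≠ 0 → MvPolynomial.constantCoeff P = 0 →
        MvPolynomial.aeval f P ≠ 0 := fun h P hP hP0 =>
    ne_zero_of_mem_hypercyclicVectors (h P hP hP0)
  have hdense : ∀ᶠ f : ℕ → X in residual (ℕ → X),
      Dense (generatedAlgebra f : Set X) := by
    filter_upwards [eventually_residual_dense_range X] with f hf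
    exact hf.mono (NonUnitalAlgebra.subset_adjoin ℂ)
  obtain ⟨f, hf, hfd⟩ := (dense_of_mem_residual ((hgen ℕ).and hdense)).nonempty
  have hsub : (generatedAlgebra f : Set X) ⊆
      hypercyclicVectors T ∪ {0} := fun x hx => by
    by_cases hx0 : x = 0
    · exact Or.inr hx0
    · exact Or.inl (isHypercyclicAlgebra_generatedAlgebra hf x hx hx0)
  have hinj := aeval_injective_of_aeval_ne_zero (hne hf)
  have hfinj : Function.Injective f := fun i j hij =>
    MvPolynomial.X_injective (R := ℂ) (hinj (by simpa using hij))
  refine ⟨⟨_, hsub, hfd, not_isFinitelyGeneratedAlgebra_generatedAlgebra hinj⟩, fun N _ => ?_, ?_,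
    #ℕ, Cardinal.mk_nat.ge, _, hsub, hfd,
    (freelyGenerates_of_aeval_ne_zero (hne hf)).isFreeAlgebraOfCardinal hfinj⟩
  · filter_upwards [hgen (Fin N)] with f hf
    exact ⟨freelyGenerates_of_aeval_ne_zero (hne hf), isHypercyclicAlgebra_generatedAlgebra hf⟩
  · filter_upwards [hgen ℕ, hdense] with f hf hfd
    exact ⟨freelyGenerates_of_aeval_ne_zero (hne hf), hfd,
      isHypercyclicAlgebra_generatedAlgebra hf⟩

/-! ### Application to convolution operators -/

section ConvolutionOperator

noncomputable local instance : CommRing entireFunctions := entireFunctions.toCommRing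

theorem eventually_residual_aeval_hypercyclic_convolutionOperator (Φ : ℂ → ℂ)
    (hΦ : IsEntireOfExponentialType Φ) (hΦ0 : ‖Φ 0‖ < 1)
    (Γ : Set ℂ) (hΓ : IsCompactArc Γ) (hΓnontrivial : Γ.Nontrivial)
    (hΓconvex : IsStrictlyConvexArc Γ) (hΓlevel : Γ ⊆ {z | ‖Φ z‖ = 1})
    (hconv : convexHull ℝ (Γ ∪ {0}) \ Γ ⊆ {z | ‖Φ z‖ < 1}) (ι : Type) [Countable ι] :
    ∀ᶠ f : ι → entireFunctions in residual (ι → entireFunctions), ∀ P : MvPolynomial ι ℂ, P ≠ 0 →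
      MvPolynomial.constantCoeff P = 0 →
        MvPolynomial.aeval f P ∈ hypercyclicVectors (convolutionOperator Φ) := by
  obtain ⟨x, hx⟩ := hΓnontrivial.nonempty
  refine eventually_residual_aeval_hypercyclic (T := convolutionLinearMap hΦ) (Γ := Γ)
    continuous_expEntire expEntire_zero expEntire_add (continuous_convolutionOperator hΦ)
    hΦ.1.continuous (convolutionOperator_expEntire hΦ)
    (dense_span_expEntire (hΓ.accPt hΓnontrivial hx)) (fun η hη => ?_) (fun y hy => ?_)
    fun s hs t => norm_lt_one_of_subconvex_combination hΦ.1 hΦ0 hΓ hΓnontrivial hΓconvex hΓlevel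
      hconv (γ := fun j : s => (j : ℂ)) (fun j => hs j.2) Subtype.val_injective
  -- Every ball around 0 accumulates at its centre, so exponentials of arbitrarily small frequency
  -- already span a dense subspace.
  · refine dense_span_expEntire (a := 0) ?_
    rw [accPt_iff_frequently_nhdsNE]
    refine Eventually.frequently ?_
    exact nhdsWithin_le_nhds (Metric.closedBall_mem_nhds 0 hη)
  · have hy1 : ‖Φ y‖ = 1 := hΓlevel hy
    rw [← hy1]
    exact frequently_norm_lt hΦ.1 (a := 0) fun h => hΦ0.ne (h ▸ hy1)

theorem convolutionOperator_algebrable (Φ : ℂ → ℂ) (hΦ : IsEntireOfExponentialType Φ)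
    (hΦ0 : ‖Φ 0‖ < 1)
    (Γ : Set ℂ) (hΓ : IsCompactArc Γ) (hΓnontrivial : Γ.Nontrivial)
    (hΓconvex : IsStrictlyConvexArc Γ) (hΓlevel : Γ ⊆ {z | ‖Φ z‖ = 1})
    (hconv : convexHull ℝ (Γ ∪ {0}) \ Γ ⊆ {z | ‖Φ z‖ < 1}) :
    IsDenseAlgebrable (hypercyclicVectors (convolutionOperator Φ)) ∧
    (∀ N : ℕ, 1 ≤ N →
      {f : Fin N → entireFunctions | FreelyGenerates f ∧
        IsHypercyclicAlgebra (convolutionOperator Φ) (generatedAlgebra f)} ∈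
          residual (Fin N → entireFunctions)) ∧
    {f : ℕ → entireFunctions | FreelyGenerates f ∧
      Dense (generatedAlgebra f : Set entireFunctions) ∧
      IsHypercyclicAlgebra (convolutionOperator Φ) (generatedAlgebra f)} ∈
        residual (ℕ → entireFunctions) ∧
    IsDenselyStronglyAlgebrable (hypercyclicVectors (convolutionOperator Φ)) :=
  algebrable_of_eventually_residual (convolutionLinearMap hΦ) fun ι _ =>
    eventually_residual_aeval_hypercyclic_convolutionOperator Φ hΦ hΦ0 Γ hΓ hΓnontrivial
      hΓconvex hΓlevel hconv ι

end ConvolutionOperator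

theorem theorem1 (Φ : ℂ → ℂ) (hΦ : IsEntireOfExponentialType Φ) (hΦ0 : ‖Φ 0‖ < 1)
    (Γ : Set ℂ) (hΓ : IsCompactArc Γ) (hΓnontrivial : Γ.Nontrivial)
    (hΓconvex : IsStrictlyConvexArc Γ) (hΓlevel : Γ ⊆ {z | ‖Φ z‖ = 1})
    (hconv : convexHull ℝ (Γ ∪ {0}) \ Γ ⊆ {z | ‖Φ z‖ < 1}) :
    IsDenseAlgebrable (hypercyclicVectors (convolutionOperator Φ)) ∧
    (∀ N : ℕ, 1 ≤ N →
      {f : Fin N → entireFunctions | FreelyGenerates f ∧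
        IsHypercyclicAlgebra (convolutionOperator Φ) (generatedAlgebra f)} ∈
          residual (Fin N → entireFunctions)) ∧
    {f : ℕ → entireFunctions | FreelyGenerates f ∧
      Dense (generatedAlgebra f : Set entireFunctions) ∧
      IsHypercyclicAlgebra (convolutionOperator Φ) (generatedAlgebra f)} ∈
        residual (ℕ → entireFunctions) ∧
    IsDenselyStronglyAlgebrable (hypercyclicVectors (convolutionOperator Φ)) :=
  convolutionOperator_algebrable Φ hΦ hΦ0 Γ hΓ hΓnontrivial hΓconvex hΓlevel hconv
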